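/- All graphs are finite, simple and connected. For a connected graph $G$ with distance $d$, let $\varepsilon(v)=\max_u d(u,v)$ be the eccentricity of the vertex $v$. The eccentricity matrix $\mathcal A(G)$ has $(u,v)$ entry $d(u,v)$ if $d(u,v)=\min\{\varepsilon(u),\varepsilon(v)\}$, and $0$ otherwise. Its $\mathcal A$-spectrum is the multiset of the eigenvalues of this real symmetric matrix, and $m(-1)$ is the multiplicity of $-1$ in it ($0$ if $-1$ is not an eigenvalue). $G$ is said to be determined by its $\mathcal A$-spectrum if every connected graph with the same $\mathcal A$-spectrum is isomorphic to $G$. Let $K_k,P_k,C_k$ be the complete graph, path and cycle on $k$ vertices, $\cup$ the disjoint union, $kH$ the disjoint union of $k$ copies of $H$, $\vee$ the join, and let $H_1$ be the bull graph: a path $v_1v_2v_3v_4$ together with a fifth vertex adjacent exactly to $v_2$ and $v_3$. **Theorem.** Let $G$ be a connected graph on $n$ vertices. (i) $m(-1)=n-1$ if and only if $G\cong K_n$. (ii) $m(-1)\neq n-2$. (iii) If $n\ge 4$, then $m(-1)=n-3$ if and only if $G$ is isomorphic to $P_4$ or to $K_{n-2}\vee 2K_1$. (iv) If $n\ge 9$,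 then $m(-1)=n-4$ if and only if $G$ is isomorphic to $K_{n-3}\vee(K_2\cup K_1)$ or to $K_{n-3}\vee 3K_1$. (v) If $n\ge 16$, then $m(-1)=n-5$ if and only if $G$ is isomorphic to one of the ten graphs $K_{n-4}\vee 4K_1$, $K_{n-4}\vee(2K_1\cup K_2)$, $K_{n-4}\vee(P_3\cup K_1)$, $K_{n-4}\vee 2K_2$, $K_{n-4}\vee P_4$, $K_{n-4}\vee(K_3\cup K_1)$, $K_{n-4}\vee C_4$, $K_{n-5}\vee C_5$, $K_{n-5}\vee(K_1\cup P_4)$, $K_{n-5}\vee H_1$. Moreover, each graph listed in (i), (iii), (iv) and (v), for $n$ in the stated range, is determined by its $\mathcal A$-spectrum. -/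

import Mathlib

namespace EccentricityMatrix

universe u v

/-- The join `G ∨ H`: the disjoint union of `G` and `H` together with all edges between
a vertex of `G` and a vertex of `H`. -/
def join {V : Type u} {W : Type v} (G : SimpleGraph V) (H : SimpleGraph W) :
    SimpleGraph (V ⊕ W) :=
  SimpleGraph.sum G H ⊔ completeBipartiteGraph V W

/-- The complete graph `K_k`. -/
abbrev K (k : ℕ) : SimpleGraph (Fin k) := SimpleGraph.completeGraph (Fin k)

/-- The graph `k K_1`: `k` isolated vertices. -/
abbrev isolated (k : ℕ) : SimpleGraph (Fin k) := SimpleGraph.emptyGraph (Fin k)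

/-- The path `P_k` on `k` vertices. -/
abbrev P (k : ℕ) : SimpleGraph (Fin k) := SimpleGraph.pathGraph k

/-- The cycle `C_k` on `k` vertices. -/
abbrev C (k : ℕ) : SimpleGraph (Fin k) := SimpleGraph.cycleGraph k

/-- The bull graph `H_1`: the path `0 - 1 - 2 - 3` and a fifth vertex `4` adjacent exactly to the
two inner vertices `1` and `2`. -/
def bull : SimpleGraph (Fin 5) :=
  SimpleGraph.fromEdgeSet {s(0, 1), s(1, 2), s(2, 3), s(4, 1), s(4, 2)}

/-- The graphs `G` and `H` are isomorphic. -/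
def Isom {V : Type u} {W : Type v} (G : SimpleGraph V) (H : SimpleGraph W) : Prop :=
  Nonempty (SimpleGraph.Iso G H)

open Classical in
/-- The eccentricity matrix: the `(u, v)` entry is the distance `d(u, v)` if this equals the
smaller one of the eccentricities of `u` and `v`, and is `0` otherwise. -/
noncomputable def eccMatrix {V : Type u} (G : SimpleGraph V) : Matrix V V ℝ :=
  Matrix.of fun a b =>
    if G.edist a b = min (G.eccent a) (G.eccent b) then (G.dist a b : ℝ) else 0

/-- The spectrum of the eccentricity matrix: the multiset of its eigenvalues, that is, of the roots
of its characteristic polynomial (all of which are real, as the matrix is real symmetric). -/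
noncomputable def eccSpectrum {V : Type u} [Fintype V] [DecidableEq V] (G : SimpleGraph V) :
    Multiset ℝ :=
  (eccMatrix G).charpoly.roots

/-- The multiplicity of `ξ` as an eigenvalue of the eccentricity matrix. -/
noncomputable def eccMult {V : Type u} [Fintype V] [DecidableEq V] (G : SimpleGraph V) (ξ : ℝ) :
    ℕ :=
  (eccMatrix G).charpoly.rootMultiplicity ξ

/-- `G` is determined by the spectrum of its eccentricity matrix: every connected finite graph with
the same spectrum is isomorphic to `G`. -/
def DeterminedByEccSpectrum {V : Type u} [Fintype V] [DecidableEq V] (G : SimpleGraph V) : Prop :=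
  ∀ (W : Type u) [Fintype W] [DecidableEq W] (H : SimpleGraph W),
    H.Connected → eccSpectrum H = eccSpectrum G → Isom H G

/-- `G ∈ {P_4, K_{n-2} ∨ 2K_1}`. -/
def InFamily3 {V : Type u} (n : ℕ) (G : SimpleGraph V) : Prop :=
  Isom G (P 4) ∨ Isom G (join (K (n - 2)) (isolated 2))

/-- `G ∈ {K_{n-3} ∨ (K_2 ∪ K_1), K_{n-3} ∨ 3K_1}`. -/
def InFamily4 {V : Type u} (n : ℕ) (G : SimpleGraph V) : Prop :=
  Isom G (join (K (n - 3)) (SimpleGraph.sum (K 2) (K 1))) ∨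
  Isom G (join (K (n - 3)) (isolated 3))

/-- `G` is one of the seven graphs `K_{n-4} ∨ H` with `H` one of
`4K_1`, `2K_1 ∪ K_2`, `P_3 ∪ K_1`, `2K_2`, `P_4`, `K_3 ∪ K_1`, `C_4`, or one of
`K_{n-5} ∨ C_5`, `K_{n-5} ∨ (K_1 ∪ P_4)`, `K_{n-5} ∨ H_1`. -/
def InFamily5 {V : Type u} (n : ℕ) (G : SimpleGraph V) : Prop :=
  Isom G (join (K (n - 4)) (isolated 4)) ∨
  Isom G (join (K (n - 4)) (SimpleGraph.sum (isolated 2) (K 2))) ∨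
  Isom G (join (K (n - 4)) (SimpleGraph.sum (P 3) (K 1))) ∨
  Isom G (join (K (n - 4)) (SimpleGraph.sum (K 2) (K 2))) ∨
  Isom G (join (K (n - 4)) (P 4)) ∨
  Isom G (join (K (n - 4)) (SimpleGraph.sum (K 3) (K 1))) ∨
  Isom G (join (K (n - 4)) (C 4)) ∨
  Isom G (join (K (n - 5)) (C 5)) ∨
  Isom G (join (K (n - 5)) (SimpleGraph.sum (K 1) (P 4))) ∨
  Isom G (join (K (n - 5)) bull)

end EccentricityMatrix

/-! Put M = A(G) + I, an integer matrix. As A(G) is symmetric, m(-1) = n - rank M, so the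
classification lists the connected graphs with rank M equal to 1, 2, 3, 4 or 5. Most lower bounds on
the rank come from one remark: a principal submatrix whose off-diagonal entries are divisible by
some e ≥ 2 is the identity modulo e, hence nonsingular.

If no vertex is universal, all eccentricities are at least 2. Vertices of equal eccentricity e give
such a submatrix, so each eccentricity class has at most rank M vertices. A diametral path gives
rank M ≥ D for the diameter D ≥ 3, and eccentricities lie between D/2 and D. Hence n is at most 8
for rank 4 and at most 15 for rank 5, while rank 3 with n ≥ 4 leaves only P_4
(`IsDiametral.shiftedRank_dichotomy`).

Otherwise G = K_r ∨ H with r ≥ 1 and no universal vertex in H. Then M repeats rows and columns of a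
quotient matrix of order h + 1, where h = |H|, whose determinant is that of the Seidel matrix S of
H. So rank M is h or h + 1, and it is h + 1 when det S ≠ 0. The determinant is nonzero for h ≤ 4 (h
= 1 does not occur), and for h = 5 it vanishes exactly for C_5, K_1 ∪ P_4 and the bull.

The spectrum fixes n, rank M and all traces of powers of M. For K_r ∨ H these are polynomials in r
with coefficients read off from H; the second, third and fourth separate the members of each family.
-/

namespace EccentricityMatrix

open Polynomial Matrix

/-! ### Ranks, multiplicities and traces of symmetric matrices. -/

section LinearAlgebra

variable {V : Type*} [Fintype V] [DecidableEq V] {ι κ : Type*} [Fintype ι] [DecidableEq ι]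
  [Fintype κ] [DecidableEq κ]

theorem card_le_rank_of_det_submatrix_ne_zero (M : Matrix V V ℝ) (f g : ι → V)
    (h : (M.submatrix f g).det ≠ 0) : Fintype.card ι ≤ M.rank := by
  have h1 : M.submatrix f g =
      ((1 : Matrix V V ℝ).submatrix f id * M) * (1 : Matrix V V ℝ).submatrix id g := by
    ext i j
    simp [Matrix.mul_apply, Matrix.one_apply]
  have h2 : (M.submatrix f g).rank = Fintype.card ι :=
    Matrix.rank_of_isUnit _ ((Matrix.isUnit_iff_isUnit_det _).2 (isUnit_iff_ne_zero.2 h))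
  rw [← h2, h1]
  exact (Matrix.rank_mul_le_left _ _).trans (Matrix.rank_mul_le_right _ _)

/-- The real rank of an integer matrix. -/
noncomputable def intRank (N : Matrix V V ℤ) : ℕ := (N.map (Int.cast : ℤ → ℝ)).rank

theorem card_le_intRank (N : Matrix V V ℤ) (f g : ι → V)
    (h : (N.submatrix f g).det ≠ 0) : Fintype.card ι ≤ intRank N := by
  apply card_le_rank_of_det_submatrix_ne_zero _ f g
  rw [Matrix.submatrix_map]
  have := Int.cast_det (R := ℝ) (N.submatrix f g)
  rw [← this]
  exact_mod_cast h

/-- Modulo e the matrix is the identity, so its determinant is 1 in `ZMod e`, which is not 0 as e ≥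
2. -/
theorem det_ne_zero_of_dvd (N : Matrix ι ι ℤ) (e : ℕ) (he : 2 ≤ e) (h1 : ∀ i, N i i = 1)
    (h2 : ∀ i j, i ≠ j → (e : ℤ) ∣ N i j) : N.det ≠ 0 := by
  intro h
  have h3 : ((N.det : ℤ) : ZMod e) = 1 := by
    rw [Int.cast_det]
    have : N.map (Int.cast : ℤ → ZMod e) = 1 := by
      ext i j
      by_cases hij : i = j
      · subst hij; simp [h1]
      · simpa [Matrix.one_apply, hij] using (ZMod.intCast_zmod_eq_zero_iff_dvd _ _).2 (h2 i j hij)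
    rw [this, Matrix.det_one]
  rw [h] at h3
  have : Fact (1 < e) := ⟨he⟩
  simp at h3

theorem card_le_intRank_of_dvd (N : Matrix V V ℤ) (T : Finset V) (e : ℕ) (he : 2 ≤ e)
    (h1 : ∀ i, N i i = 1) (h2 : ∀ i ∈ T, ∀ j ∈ T, i ≠ j → (e : ℤ) ∣ N i j) :
    T.card ≤ intRank N := by
  have := card_le_intRank N (fun i : T => (i : V)) (fun i : T => (i : V))
    (det_ne_zero_of_dvd _ e he (fun i => h1 i)
      (fun i j hij => h2 i i.2 j j.2 (fun h => hij (Subtype.ext h))))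
  simpa using this

/-- A star: `k` pairwise vanishing positions together with one further index. -/
theorem succ_le_intRank_of_star (N : Matrix V V ℤ) {k : ℕ} (f : Fin k → V) (v : V)
    (h1 : ∀ i, N i i = 1) (hf : ∀ i j, i ≠ j → N (f i) (f j) = 0)
    (hs : ∀ i, N (f i) v = N v (f i)) (h2 : ∀ i, N v (f i) = 0 ∨ 2 ≤ N v (f i)) :
    k + 1 ≤ intRank N := by
  let g : Fin k ⊕ Unit → V := Sum.elim f (fun _ => v)
  have key : N.submatrix g g = fromBlocks 1 (of fun i _ => N v (f i)) (of fun _ i => N v (f i))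
      (of fun _ _ => 1) := by
    ext i j
    rcases i with i | i <;> rcases j with j | j
    · by_cases hij : i = j
      · subst hij; simp [g, h1]
      · simp [g, hf i j hij, hij]
    · simp [g, hs]
    · simp [g]
    · simp [g, h1]
  have := card_le_intRank N g g (by
    -- The Schur complement is 1 - ∑ aᵢ² with each aᵢ zero or at least 2, so it is 1 or at most -3.
    rw [key, det_fromBlocks_one₁₁, det_unique]
    simp only [Matrix.sub_apply, Matrix.mul_apply, of_apply]
    by_cases h : ∀ i, N v (f i) = 0
    · simp [h]
    · push Not at h
      obtain ⟨i, hi⟩ := h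
      have h4 : 2 ≤ N v (f i) := (h2 i).resolve_left hi
      have h5 : N v (f i) * N v (f i) ≤ ∑ i, N v (f i) * N v (f i) :=
        Finset.single_le_sum (f := fun i => N v (f i) * N v (f i))
          (fun i _ => mul_self_nonneg _) (Finset.mem_univ i)
      nlinarith)
  simpa using this

/-- Diagonalizability makes algebraic and geometric multiplicity agree: the rank of A + I counts the
eigenvalues of A + I that are nonzero. -/
theorem rootMultiplicity_neg_one_add_rank (A : Matrix V V ℝ) (hA : A.IsHermitian) :
    A.charpoly.rootMultiplicity (-1) + (A + 1).rank = Fintype.card V := by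
  have hM : (A + 1).IsHermitian := hA.add Matrix.isHermitian_one
  have h1 : A.charpoly.rootMultiplicity (-1) = (A + 1).charpoly.rootMultiplicity 0 := by
    rw [rootMultiplicity_eq_rootMultiplicity, ← Matrix.charpoly_sub_scalar]
    congr 2
    ext i j
    simp [Matrix.scalar_apply, Matrix.one_apply, Matrix.diagonal_apply]
    split_ifs <;> simp
  rw [h1, hM.rank_eq_card_non_zero_eigs, ← count_roots, hM.roots_charpoly_eq_eigenvalues]
  rw [Fintype.card_subtype, ← Finset.card_univ,
    ← Finset.card_filter_add_card_filter_not (s := Finset.univ) (fun i => hM.eigenvalues i = 0)]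
  congr 1
  rw [Multiset.count_map, Finset.card_def, Finset.filter_val]
  congr 1
  apply Multiset.filter_congr
  intro x _
  simp [eq_comm]

theorem trace_add_one_pow (A : Matrix V V ℝ) (hA : A.IsHermitian) (k : ℕ) :
    ((A + 1) ^ k).trace = (A.charpoly.roots.map fun x => (x + 1) ^ k).sum := by
  rw [hA.roots_charpoly_eq_eigenvalues]
  have h := hA.spectral_theorem
  have h2 : (A + 1) ^ k = Unitary.conjStarAlgAut ℝ _ hA.eigenvectorUnitary
      ((diagonal (RCLike.ofReal ∘ hA.eigenvalues) + 1) ^ k) := by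
    rw [map_pow, map_add, map_one, ← h]
  rw [h2, Unitary.conjStarAlgAut_apply, Matrix.trace_mul_cycle]
  simp [← Matrix.diagonal_one, Matrix.diagonal_pow]

theorem card_roots_charpoly (A : Matrix V V ℝ) (hA : A.IsHermitian) :
    Multiset.card A.charpoly.roots = Fintype.card V := by
  rw [hA.roots_charpoly_eq_eigenvalues]; simp

/-- XY and YX have the same nonzero spectrum. This moves moments from a matrix of order r + h to one
of order h + 1; the exponent must be positive because the orders differ. -/
theorem trace_mul_pow_comm (X : Matrix V ι ℝ) (Y : Matrix ι V ℝ) (k : ℕ) :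
    ((X * Y) ^ (k + 1)).trace = ((Y * X) ^ (k + 1)).trace := by
  have h : ∀ k : ℕ, (X * Y) ^ (k + 1) = X * (Y * X) ^ k * Y := by
    intro k
    induction k with
    | zero => simp
    | succ k ih => rw [pow_succ, ih, pow_succ]; simp only [Matrix.mul_assoc]
  rw [h, Matrix.trace_mul_cycle, pow_succ', Matrix.mul_assoc]

theorem rank_lt_of_det_eq_zero (N : Matrix ι ι ℝ) (h : N.det = 0) : N.rank < Fintype.card ι := by
  refine lt_of_le_of_ne (Matrix.rank_le_card_width _) fun h1 => ?_
  have h2 : LinearIndependent ℝ N.col := by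
    rw [linearIndependent_iff_card_eq_finrank_span, ← h1, Matrix.rank_eq_finrank_span_cols]
    rfl
  have h3 := (Matrix.linearIndependent_cols_iff_isUnit).1 h2
  rw [Matrix.isUnit_iff_isUnit_det, h] at h3
  simp at h3

end LinearAlgebra

end EccentricityMatrix

namespace EccentricityMatrix

open Matrix

/-! ### The matrix A(G) + I and its invariants. -/

section Basic

universe u v

variable {V : Type u} [Fintype V] (G : SimpleGraph V)

/-- The eccentricity of a vertex as a natural number. -/
noncomputable def ecc (v : V) : ℕ := Finset.univ.sup (G.dist v)

theorem dist_le_ecc (u v : V) : G.dist u v ≤ ecc G u :=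
  Finset.le_sup (f := G.dist u) (Finset.mem_univ v)

theorem dist_le_ecc' (u v : V) : G.dist u v ≤ ecc G v := by
  rw [SimpleGraph.dist_comm]; exact dist_le_ecc G v u

theorem ecc_le_iff (v : V) (k : ℕ) : ecc G v ≤ k ↔ ∀ w, G.dist v w ≤ k := by
  simp [ecc, Finset.sup_le_iff]

theorem exists_dist_eq_ecc (v : V) : ∃ w, G.dist v w = ecc G v := by
  have : (Finset.univ : Finset V).Nonempty := ⟨v, Finset.mem_univ v⟩
  obtain ⟨w, -, hw⟩ := Finset.exists_mem_eq_sup _ this (G.dist v)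
  exact ⟨w, hw.symm⟩

variable {G}

theorem eccent_eq_coe (hG : G.Connected) (v : V) : G.eccent v = (ecc G v : ℕ∞) := by
  apply le_antisymm
  · rw [SimpleGraph.eccent_le_iff]
    intro w
    rw [← (hG v w).coe_dist_eq_edist]
    exact_mod_cast dist_le_ecc G v w
  · obtain ⟨w, hw⟩ := exists_dist_eq_ecc G v
    rw [← hw, (hG v w).coe_dist_eq_edist]
    exact SimpleGraph.edist_le_eccent

variable [DecidableEq V]

variable (G) in
/-- The matrix `A(G) + I`, with integer entries. -/
noncomputable def shiftedMatrix : Matrix V V ℤ :=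
  of fun a b => if a = b then 1 else if G.dist a b = min (ecc G a) (ecc G b) then G.dist a b else 0

theorem shiftedMatrix_self (a : V) : shiftedMatrix G a a = 1 := by simp [shiftedMatrix]

theorem shiftedMatrix_ne {a b : V} (h : a ≠ b) : shiftedMatrix G a b =
    if G.dist a b = min (ecc G a) (ecc G b) then (G.dist a b : ℤ) else 0 := by
  simp [shiftedMatrix, h]

theorem shiftedMatrix_comm (a b : V) : shiftedMatrix G a b = shiftedMatrix G b a := by
  by_cases h : a = b
  · rw [h]
  · rw [shiftedMatrix_ne h, shiftedMatrix_ne (Ne.symm h), SimpleGraph.dist_comm, min_comm]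

theorem eccMatrix_add_one (hG : G.Connected) :
    eccMatrix G + 1 = (shiftedMatrix G).map (Int.cast : ℤ → ℝ) := by
  ext a b
  by_cases h : a = b
  · subst h; simp [eccMatrix, shiftedMatrix_self]
  · simp only [Matrix.add_apply, Matrix.one_apply_ne h, map_apply, shiftedMatrix_ne h, eccMatrix,
      of_apply, add_zero]
    have : G.edist a b = min (G.eccent a) (G.eccent b) ↔
        G.dist a b = min (ecc G a) (ecc G b) := by
      rw [eccent_eq_coe hG, eccent_eq_coe hG, ← (hG a b).coe_dist_eq_edist]
      rw [← Nat.mono_cast.map_min, Nat.cast_inj]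
    simp only [this]
    split_ifs <;> simp

omit [Fintype V] [DecidableEq V] in
theorem eccMatrix_isHermitian : (eccMatrix G).IsHermitian := by
  ext a b
  simp only [conjTranspose_apply, eccMatrix, of_apply, star_trivial]
  rw [SimpleGraph.edist_comm, min_comm, SimpleGraph.dist_comm]

variable (G) in
/-- The rank of `A(G) + I`. -/
noncomputable def shiftedRank : ℕ := intRank (shiftedMatrix G)

theorem eccMult_add_shiftedRank (hG : G.Connected) :
    eccMult G (-1) + shiftedRank G = Fintype.card V := by
  have := rootMultiplicity_neg_one_add_rank (eccMatrix G) eccMatrix_isHermitian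
  rwa [eccMatrix_add_one hG] at this

variable (G) in
/-- The trace of `(A(G) + I) ^ k`. -/
noncomputable def shiftedMoment (k : ℕ) : ℝ :=
  (((shiftedMatrix G).map (Int.cast : ℤ → ℝ)) ^ k).trace

variable {W : Type v} [Fintype W] [DecidableEq W] {H : SimpleGraph W}

theorem shiftedMoment_eq_of_eccSpectrum_eq (hG : G.Connected) (hH : H.Connected)
    (h : eccSpectrum G = eccSpectrum H) (k : ℕ) : shiftedMoment G k = shiftedMoment H k := by
  rw [shiftedMoment, shiftedMoment, ← eccMatrix_add_one hG, ← eccMatrix_add_one hH,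
    trace_add_one_pow _ eccMatrix_isHermitian, trace_add_one_pow _ eccMatrix_isHermitian]
  rw [eccSpectrum, eccSpectrum] at h
  rw [h]

theorem card_eq_of_eccSpectrum_eq (h : eccSpectrum G = eccSpectrum H) :
    Fintype.card V = Fintype.card W := by
  rw [← card_roots_charpoly _ (eccMatrix_isHermitian (G := G)),
    ← card_roots_charpoly _ (eccMatrix_isHermitian (G := H))]
  exact congrArg _ h

theorem eccMult_eq_of_eccSpectrum_eq (h : eccSpectrum G = eccSpectrum H) (ξ : ℝ) :
    eccMult G ξ = eccMult H ξ := by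
  rw [eccMult, eccMult, ← Polynomial.count_roots, ← Polynomial.count_roots]
  exact congrArg _ h

omit [Fintype V] [DecidableEq V] [Fintype W] [DecidableEq W] in
theorem dist_iso_le (hG : G.Connected) (e : G ≃g H) (a b : V) :
    H.dist (e a) (e b) ≤ G.dist a b := by
  obtain ⟨p, hp⟩ := hG.exists_walk_length_eq_dist a b
  rw [← hp, ← SimpleGraph.Walk.length_map e.toHom p]
  exact SimpleGraph.dist_le _

omit [Fintype V] [DecidableEq V] [Fintype W] [DecidableEq W] in
theorem dist_iso (hG : G.Connected) (e : G ≃g H) (a b : V) :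
    H.dist (e a) (e b) = G.dist a b := by
  refine le_antisymm (dist_iso_le hG e a b) ?_
  have := dist_iso_le (e.connected_iff.1 hG) e.symm (e a) (e b)
  simpa using this

omit [DecidableEq V] [DecidableEq W] in
theorem ecc_iso (hG : G.Connected) (e : G ≃g H) (a : V) : ecc H (e a) = ecc G a := by
  apply eq_of_forall_ge_iff
  intro k
  rw [ecc_le_iff, ecc_le_iff]
  constructor
  · intro h w; rw [← dist_iso hG e]; exact h _
  · intro h w
    obtain ⟨w, rfl⟩ := e.surjective w
    rw [dist_iso hG e]; exact h _

theorem shiftedMatrix_iso (hG : G.Connected) (e : G ≃g H) :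
    shiftedMatrix G = (shiftedMatrix H).submatrix e e := by
  ext a b
  simp [shiftedMatrix, dist_iso hG e, ecc_iso hG e]

theorem shiftedRank_iso (hG : G.Connected) (h : Isom G H) : shiftedRank G = shiftedRank H := by
  obtain ⟨e⟩ := h
  rw [shiftedRank, shiftedRank, intRank, intRank, shiftedMatrix_iso hG e, ← Matrix.submatrix_map]
  exact Matrix.rank_submatrix _ e.toEquiv e.toEquiv

theorem shiftedMoment_iso (hG : G.Connected) (h : Isom G H) (k : ℕ) :
    shiftedMoment G k = shiftedMoment H k := by
  obtain ⟨e⟩ := h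
  rw [shiftedMoment, shiftedMoment, shiftedMatrix_iso hG e, ← Matrix.submatrix_map]
  have h1 : ∀ (M : Matrix W W ℝ) (k : ℕ), (M.submatrix e e) ^ k = (M ^ k).submatrix e e := by
    intro M k
    exact (map_pow (Matrix.reindexAlgEquiv ℝ ℝ e.symm.toEquiv) M k).symm
  rw [h1]
  simp only [Matrix.trace, Matrix.diag_apply, Matrix.submatrix_apply]
  exact e.toEquiv.sum_comp (fun i => (Matrix.map (shiftedMatrix H) (Int.cast : ℤ → ℝ) ^ k) i i)

omit [Fintype V] [DecidableEq V] [Fintype W] [DecidableEq W] in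
theorem Isom.symm (h : Isom G H) : Isom H G := h.map SimpleGraph.Iso.symm

omit [Fintype V] [DecidableEq V] [Fintype W] [DecidableEq W] in
theorem Isom.trans {X : Type*} {K : SimpleGraph X} (h : Isom G H) (h' : Isom H K) : Isom G K := by
  obtain ⟨e⟩ := h
  obtain ⟨e'⟩ := h'
  exact ⟨e.trans e'⟩

end Basic

end EccentricityMatrix

namespace EccentricityMatrix

open Matrix

/-! ### Rank bounds from eccentricity classes and diametral paths; the path P_4. -/

section Diameter

universe u v

variable {V : Type u} {G : SimpleGraph V}

theorem exists_geodesic (hG : G.Connected) (a b : V) :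
    ∃ f : ℕ → V, ∀ i j, i ≤ j → j ≤ G.dist a b → G.dist (f i) (f j) = j - i := by
  obtain ⟨p, hp⟩ := hG.exists_walk_length_eq_dist a b
  have step : ∀ i j, i ≤ j → j ≤ p.length → G.dist (p.getVert i) (p.getVert j) ≤ j - i := by
    intro i j hij hj
    induction j, hij using Nat.le_induction with
    | base => simp
    | succ j hij ih =>
      have h1 := hG.dist_triangle (u := p.getVert i) (v := p.getVert j) (w := p.getVert (j + 1))
      have h2 : G.dist (p.getVert j) (p.getVert (j + 1)) = 1 :=
        SimpleGraph.dist_eq_one_iff_adj.2 (p.adj_getVert_succ (by omega))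
      have := ih (by omega)
      omega
  refine ⟨p.getVert, fun i j hij hj => le_antisymm (step i j hij (hp ▸ hj)) ?_⟩
  have h1 := step 0 i (by omega) (by omega)
  have h2 := step j p.length (by omega) le_rfl
  simp only [SimpleGraph.Walk.getVert_zero, SimpleGraph.Walk.getVert_length] at h1 h2
  -- If the middle piece could be shortened, so could the whole shortest walk from a to b.
  have h3 := hG.dist_triangle (u := a) (v := p.getVert i) (w := b)
  have h4 := hG.dist_triangle (u := p.getVert i) (v := p.getVert j) (w := b)
  omega

variable [Fintype V] [DecidableEq V]

theorem shiftedMatrix_ne_nat {a b : V} (h : a ≠ b) : shiftedMatrix G a b =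
    ((if G.dist a b = min (ecc G a) (ecc G b) then G.dist a b else 0 : ℕ) : ℤ) := by
  rw [shiftedMatrix_ne h]; split_ifs <;> simp

theorem shiftedMatrix_eq_zero_or {a b : V} (h : a ≠ b) :
    shiftedMatrix G a b = 0 ∨ shiftedMatrix G a b = (min (ecc G a) (ecc G b) : ℕ) := by
  rw [shiftedMatrix_ne_nat h]
  split_ifs with h1
  · right; rw [h1]
  · left; simp

theorem shiftedMatrix_zero_or_two_le (hr : ∀ v, 2 ≤ ecc G v) {a b : V} (h : a ≠ b) :
    shiftedMatrix G a b = 0 ∨ 2 ≤ shiftedMatrix G a b := by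
  rcases shiftedMatrix_eq_zero_or (G := G) h with h1 | h1
  · exact Or.inl h1
  · right; rw [h1]; exact_mod_cast le_min (hr a) (hr b)

/-- Vertices of the same eccentricity `e ≥ 2` index a nonsingular principal submatrix. -/
theorem card_ecc_class_le (e : ℕ) (he : 2 ≤ e) :
    (Finset.univ.filter fun v => ecc G v = e).card ≤ shiftedRank G := by
  refine card_le_intRank_of_dvd _ _ e he shiftedMatrix_self fun i hi j hj hij => ?_
  simp only [Finset.mem_filter, Finset.mem_univ, true_and] at hi hj
  rcases shiftedMatrix_eq_zero_or (G := G) hij with h1 | h1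
  · rw [h1]; exact dvd_zero _
  · rw [h1, hi, hj, min_self]

/-- Partitioning by eccentricity turns a bound on the rank into a bound on n; it is the source of
the thresholds 8 and 15. -/
theorem card_le_card_mul_shiftedRank (S : Finset ℕ) (hS : ∀ e ∈ S, 2 ≤ e)
    (h : ∀ v, ecc G v ∈ S) : Fintype.card V ≤ S.card * shiftedRank G := by
  have h1 := Finset.card_eq_sum_card_fiberwise (s := (Finset.univ : Finset V)) (t := S)
    (f := ecc G) (fun v _ => h v)
  rw [Finset.card_univ] at h1
  rw [h1, ← smul_eq_mul]
  exact Finset.sum_le_card_nsmul _ _ _ fun e he => card_ecc_class_le e (hS e he)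

omit [DecidableEq V] in
theorem le_two_mul_ecc (hG : G.Connected) (a b v : V) : G.dist a b ≤ 2 * ecc G v := by
  have h1 := hG.dist_triangle (u := a) (v := v) (w := b)
  have h2 := dist_le_ecc' G a v
  have h3 := dist_le_ecc G v b
  omega

/-- `f 0, …, f D` is a diametral path. -/
structure IsDiametral (G : SimpleGraph V) (f : ℕ → V) (D : ℕ) : Prop where
  dist_eq : ∀ i j, i ≤ j → j ≤ D → G.dist (f i) (f j) = j - i
  dist_le : ∀ u v, G.dist u v ≤ D

omit [DecidableEq V] in
theorem exists_isDiametral (hG : G.Connected) : ∃ f D, IsDiametral G f D := by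
  have := hG.nonempty
  obtain ⟨⟨a, b⟩, h⟩ := Finite.exists_max (fun p : V × V => G.dist p.1 p.2)
  obtain ⟨f, hf⟩ := exists_geodesic hG a b
  exact ⟨f, _, hf, fun u v => h (u, v)⟩

namespace IsDiametral

variable {f : ℕ → V} {D : ℕ}

omit [DecidableEq V] in
theorem ecc_le (h : IsDiametral G f D) (v : V) : ecc G v ≤ D :=
  (ecc_le_iff G v D).2 (h.dist_le v)

omit [DecidableEq V] in
theorem le_two_mul (h : IsDiametral G f D) (hG : G.Connected) (v : V) : D ≤ 2 * ecc G v := by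
  have := le_two_mul_ecc hG (f 0) (f D) v
  rwa [h.dist_eq 0 D (by omega) le_rfl] at this

omit [DecidableEq V] in
theorem le_ecc (h : IsDiametral G f D) {i : ℕ} (hi : i ≤ D) :
    i ≤ ecc G (f i) ∧ D - i ≤ ecc G (f i) := by
  have h1 := dist_le_ecc' G (f 0) (f i)
  have h2 := dist_le_ecc G (f i) (f D)
  rw [h.dist_eq _ _ (by omega) (by omega)] at h1 h2
  omega

omit [DecidableEq V] in
theorem ecc_zero (h : IsDiametral G f D) : ecc G (f 0) = D :=
  le_antisymm (h.ecc_le _) (by simpa using (h.le_ecc (Nat.zero_le D)).2)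

omit [DecidableEq V] in
theorem ecc_last (h : IsDiametral G f D) : ecc G (f D) = D :=
  le_antisymm (h.ecc_le _) (h.le_ecc le_rfl).1

omit [DecidableEq V] [Fintype V] in
theorem ne (h : IsDiametral G f D) {i j : ℕ} (hij : i < j) (hj : j ≤ D) : f i ≠ f j := by
  intro h1
  have := h.dist_eq i j hij.le hj
  rw [h1, SimpleGraph.dist_self] at this
  omega

theorem entry (h : IsDiametral G f D) {i j : ℕ} (hij : i < j) (hj : j ≤ D) :
    shiftedMatrix G (f i) (f j) =
      ((if j - i = min (ecc G (f i)) (ecc G (f j)) then j - i else 0 : ℕ) : ℤ) := by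
  rw [shiftedMatrix_ne_nat (h.ne hij hj), h.dist_eq i j hij.le hj]

/-- The distance j - i is below D - i ≤ ε(f i) because j < D, and below j ≤ ε(f j) because i > 0, so
it is not the minimum of the two eccentricities. -/
theorem entry_inner (h : IsDiametral G f D) {i j : ℕ} (hi : 0 < i) (hij : i < j) (hj : j < D) :
    shiftedMatrix G (f i) (f j) = 0 := by
  rw [h.entry hij hj.le, if_neg, Nat.cast_zero]
  have h1 := h.le_ecc (i := i) (by omega)
  have h2 := h.le_ecc (i := j) (by omega)
  omega

/-- The D - 1 inner vertices vanish pairwise, and `f 0` is the centre of the star. -/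
theorem le_shiftedRank (h : IsDiametral G f D) (hr : ∀ v, 2 ≤ ecc G v) (hD : 1 ≤ D) :
    D ≤ shiftedRank G := by
  have h0 : ∀ i : Fin (D - 1), f 0 ≠ f (i + 1) := fun i => h.ne (by omega) (by omega)
  have := succ_le_intRank_of_star (shiftedMatrix G) (k := D - 1) (fun i => f (i + 1)) (f 0)
    shiftedMatrix_self
    (fun i j hij => by
      rcases lt_or_gt_of_ne hij with h1 | h1
      · exact h.entry_inner (by omega) (by simpa using h1) (by omega)
      · rw [shiftedMatrix_comm]
        exact h.entry_inner (by omega) (by simpa using h1) (by omega))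
    (fun i => shiftedMatrix_comm _ _)
    (fun i => shiftedMatrix_zero_or_two_le hr (h0 i))
  rw [shiftedRank]
  omega

/-- The star yields only 4 when D = 4. The extra unit excludes diameter 4 from rank 4, where three
eccentricity classes would spoil the bound n ≤ 8. -/
theorem five_le_shiftedRank (h : IsDiametral G f 4) (hr : ∀ v, 2 ≤ ecc G v) :
    5 ≤ shiftedRank G := by
  have e0 := h.ecc_zero
  have e4 := h.ecc_last
  have h01 : shiftedMatrix G (f 0) (f 1) = 0 := by
    rw [h.entry (by omega) (by omega), if_neg, Nat.cast_zero]
    have := hr (f 1); omega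
  have h34 : shiftedMatrix G (f 3) (f 4) = 0 := by
    rw [h.entry (by omega) (by omega), if_neg, Nat.cast_zero]
    have := hr (f 3); omega
  have h04 : shiftedMatrix G (f 0) (f 4) = 4 := by
    rw [h.entry (by omega) (by omega), e0, e4]; rfl
  have h02 : shiftedMatrix G (f 0) (f 2) = if ecc G (f 2) = 2 then 2 else 0 := by
    rw [h.entry (by omega) (by omega), e0]
    have := hr (f 2)
    split_ifs <;> first | rfl | omega
  have h24 : shiftedMatrix G (f 2) (f 4) = if ecc G (f 2) = 2 then 2 else 0 := by
    rw [h.entry (by omega) (by omega), e4]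
    have := hr (f 2)
    split_ifs <;> first | rfl | omega
  have h03 : shiftedMatrix G (f 0) (f 3) = if ecc G (f 3) = 3 then 3 else 0 := by
    rw [h.entry (by omega) (by omega), e0]
    have := h.ecc_le (f 3)
    split_ifs <;> first | rfl | omega
  have h14 : shiftedMatrix G (f 1) (f 4) = if ecc G (f 1) = 3 then 3 else 0 := by
    rw [h.entry (by omega) (by omega), e4]
    have := h.ecc_le (f 1)
    split_ifs <;> first | rfl | omega
  have h12 := h.entry_inner (i := 1) (j := 2) (by omega) (by omega) (by omega)
  have h13 := h.entry_inner (i := 1) (j := 3) (by omega) (by omega) (by omega)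
  have h23 := h.entry_inner (i := 2) (j := 3) (by omega) (by omega) (by omega)
  -- The submatrix depends only on whether ε(f 2) = 2, ε(f 3) = 3 and ε(f 1) = 3. Treating these as
  -- arbitrary propositions leaves eight concrete determinants.
  have key : ∀ p q r : Prop, ∀ [Decidable p] [Decidable q] [Decidable r],
      shiftedMatrix G (f 0) (f 2) = (if p then 2 else 0) →
      shiftedMatrix G (f 2) (f 4) = (if p then 2 else 0) →
      shiftedMatrix G (f 0) (f 3) = (if q then 3 else 0) →
      shiftedMatrix G (f 1) (f 4) = (if r then 3 else 0) → 5 ≤ shiftedRank G := by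
    intro p q r _ _ _ h02 h24 h03 h14
    have h1 : (shiftedMatrix G).submatrix (fun i : Fin 5 => f i) (fun i : Fin 5 => f i) =
        !![1, 0, if p then 2 else 0, if q then 3 else 0, 4;
           0, 1, 0, 0, if r then 3 else 0;
           if p then 2 else 0, 0, 1, 0, if p then 2 else 0;
           if q then 3 else 0, 0, 0, 1, 0;
           4, if r then 3 else 0, if p then 2 else 0, 0, 1] := by
      ext i j
      fin_cases i <;> fin_cases j <;>
        simp [shiftedMatrix_self, h01, h34, h04, h02, h24, h03, h14, h12, h13, h23,
          shiftedMatrix_comm (f 1) (f 0), shiftedMatrix_comm (f 2) (f 0),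
          shiftedMatrix_comm (f 3) (f 0), shiftedMatrix_comm (f 4) (f 0),
          shiftedMatrix_comm (f 2) (f 1), shiftedMatrix_comm (f 3) (f 1),
          shiftedMatrix_comm (f 4) (f 1), shiftedMatrix_comm (f 3) (f 2),
          shiftedMatrix_comm (f 4) (f 2), shiftedMatrix_comm (f 4) (f 3)]
    refine card_le_intRank (shiftedMatrix G) (fun i : Fin 5 => f i) (fun i : Fin 5 => f i) ?_
    rw [h1]
    by_cases hp : p <;> by_cases hq : q <;> by_cases hr : r <;>
      simp only [hp, hq, hr, if_true, if_false] <;> decide +kernel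
  exact key _ _ _ h02 h24 h03 h14

/-- Rank at most 3 makes the minor of order four on the path vanish, and among the four possible
patterns only one has determinant 0. -/
theorem ecc_inner_of_shiftedRank_le_three (h : IsDiametral G f 3) (hr : ∀ v, 2 ≤ ecc G v)
    (hk : shiftedRank G ≤ 3) :
    ecc G (f 1) = 2 ∧ ecc G (f 2) = 2 ∧
    (shiftedMatrix G).submatrix (fun i : Fin 4 => f i) (fun i : Fin 4 => f i) =
        !![1, 0, 2, 3; 0, 1, 0, 2; 2, 0, 1, 0; 3, 2, 0, 1] := by
  have e0 := h.ecc_zero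
  have e3 := h.ecc_last
  have h01 : shiftedMatrix G (f 0) (f 1) = 0 := by
    rw [h.entry (by omega) (by omega), if_neg, Nat.cast_zero]
    have := hr (f 1); omega
  have h23 : shiftedMatrix G (f 2) (f 3) = 0 := by
    rw [h.entry (by omega) (by omega), if_neg, Nat.cast_zero]
    have := hr (f 2); omega
  have h03 : shiftedMatrix G (f 0) (f 3) = 3 := by
    rw [h.entry (by omega) (by omega), e0, e3]; rfl
  have h02 : shiftedMatrix G (f 0) (f 2) = if ecc G (f 2) = 2 then 2 else 0 := by
    rw [h.entry (by omega) (by omega), e0]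
    have := hr (f 2)
    split_ifs <;> first | rfl | omega
  have h13 : shiftedMatrix G (f 1) (f 3) = if ecc G (f 1) = 2 then 2 else 0 := by
    rw [h.entry (by omega) (by omega), e3]
    have := hr (f 1)
    split_ifs <;> first | rfl | omega
  have h12 := h.entry_inner (i := 1) (j := 2) (by omega) (by omega) (by omega)
  have key : ∀ p q : Prop, ∀ [Decidable p] [Decidable q],
      shiftedMatrix G (f 0) (f 2) = (if p then 2 else 0) →
      shiftedMatrix G (f 1) (f 3) = (if q then 2 else 0) → q ∧ p ∧
      (shiftedMatrix G).submatrix (fun i : Fin 4 => f i) (fun i : Fin 4 => f i) =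
        !![1, 0, 2, 3; 0, 1, 0, 2; 2, 0, 1, 0; 3, 2, 0, 1] := by
    intro p q _ _ h02 h13
    have h1 : (shiftedMatrix G).submatrix (fun i : Fin 4 => f i) (fun i : Fin 4 => f i) =
        !![1, 0, if p then 2 else 0, 3;
           0, 1, 0, if q then 2 else 0;
           if p then 2 else 0, 0, 1, 0;
           3, if q then 2 else 0, 0, 1] := by
      ext i j
      fin_cases i <;> fin_cases j <;>
        simp [shiftedMatrix_self, h01, h23, h03, h02, h12, h13,
          shiftedMatrix_comm (f 1) (f 0), shiftedMatrix_comm (f 2) (f 0),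
          shiftedMatrix_comm (f 3) (f 0), shiftedMatrix_comm (f 2) (f 1),
          shiftedMatrix_comm (f 3) (f 1), shiftedMatrix_comm (f 3) (f 2)]
    have h2 : ((shiftedMatrix G).submatrix (fun i : Fin 4 => f i) (fun i : Fin 4 => f i)).det = 0 := by
      by_contra h2
      have := card_le_intRank (shiftedMatrix G) _ _ h2
      rw [Fintype.card_fin] at this
      rw [shiftedRank] at hk
      omega
    rw [h1] at h2 ⊢
    by_cases hp : p <;> by_cases hq : q <;> simp only [hp, hq, if_true, if_false] at h2 ⊢
    · simp
    all_goals revert h2; decide +kernel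
  exact key _ _ h02 h13

/-- An odd off-diagonal entry 3 needs two vertices of eccentricity 3. Adding the single vertex `f 0`
to the class of eccentricity 2 therefore still gives the identity modulo 2. -/
theorem card_ecc_two_lt (h : IsDiametral G f 3) (hr : ∀ v, 2 ≤ ecc G v) :
    (Finset.univ.filter fun v => ecc G v = 2).card + 1 ≤ shiftedRank G := by
  have e0 := h.ecc_zero
  rw [← Finset.card_insert_of_notMem (a := f 0) (by simp [e0])]
  refine card_le_intRank_of_dvd _ _ 2 le_rfl shiftedMatrix_self fun i hi j hj hij => ?_
  rcases shiftedMatrix_eq_zero_or (G := G) hij with h1 | h1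
  · rw [h1]; exact dvd_zero _
  · simp only [Finset.mem_insert, Finset.mem_filter, Finset.mem_univ, true_and] at hi hj
    have h2 : min (ecc G i) (ecc G j) = 2 := by
      have := hr i
      have := hr j
      rcases hi with hi | hi
      · rcases hj with hj | hj
        · exact absurd (hi.trans hj.symm) hij
        · omega
      · omega
    rw [h1, h2]

theorem eq_of_shiftedRank_le_three (h : IsDiametral G f 3) (hr : ∀ v, 2 ≤ ecc G v)
    (hk : shiftedRank G ≤ 3) (w : V) : w = f 0 ∨ w = f 1 ∨ w = f 2 ∨ w = f 3 := by
  obtain ⟨e1, e2, hM⟩ := h.ecc_inner_of_shiftedRank_le_three hr hk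
  by_contra! hw
  obtain ⟨w0, w1, w2, w3⟩ := hw
  -- Were ε(w) = 2, the three vertices `f 1`, `f 2`, w together with `f 0` would force rank at least
  -- 4.
  have hw : ecc G w = 3 := by
    by_contra hw3
    have hw2 : ecc G w = 2 := by have := hr w; have := h.ecc_le w; omega
    have h1 := h.card_ecc_two_lt hr
    have h2 : ({f 1, f 2, w} : Finset V).card = 3 :=
      Finset.card_eq_three.2 ⟨_, _, _, h.ne (by omega) (by omega), w1.symm, w2.symm, rfl⟩
    have h3 : ({f 1, f 2, w} : Finset V) ⊆ Finset.univ.filter fun v => ecc G v = 2 := by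
      intro x hx
      simp only [Finset.mem_insert, Finset.mem_singleton] at hx
      rcases hx with rfl | rfl | rfl <;> simp [*]
    have := Finset.card_le_card h3
    omega
  have e0 := h.ecc_zero
  have e3 := h.ecc_last
  have M : ∀ i j : Fin 4, shiftedMatrix G (f i) (f j) =
      !![1, 0, 2, 3; 0, 1, 0, 2; 2, 0, 1, 0; 3, 2, 0, 1] i j := fun i j => by
    rw [← hM]; rfl
  have x0 := shiftedMatrix_eq_zero_or (G := G) w0
  have x1 := shiftedMatrix_eq_zero_or (G := G) w1
  have x2 := shiftedMatrix_eq_zero_or (G := G) w2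
  have x3 := shiftedMatrix_eq_zero_or (G := G) w3
  rw [hw] at x0 x1 x2 x3
  rw [e0] at x0
  rw [e1] at x1
  rw [e2] at x2
  rw [e3] at x3
  have hz : ∀ g : Fin 4 → V, ((shiftedMatrix G).submatrix ![f 0, f 1, f 2, w] g).det = 0 := by
    intro g
    by_contra h2
    have := card_le_intRank (shiftedMatrix G) _ _ h2
    rw [Fintype.card_fin] at this
    rw [shiftedRank] at hk
    omega
  have d1 := hz ![f 0, f 1, f 2, f 3]
  have d2 := hz ![f 0, f 1, f 2, w]
  have c0 := shiftedMatrix_comm (G := G) (f 0) w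
  have c1 := shiftedMatrix_comm (G := G) (f 1) w
  have c2 := shiftedMatrix_comm (G := G) (f 2) w
  obtain ⟨a0, ha0⟩ : ∃ a, a = shiftedMatrix G w (f 0) := ⟨_, rfl⟩
  obtain ⟨a1, ha1⟩ : ∃ a, a = shiftedMatrix G w (f 1) := ⟨_, rfl⟩
  obtain ⟨a2, ha2⟩ : ∃ a, a = shiftedMatrix G w (f 2) := ⟨_, rfl⟩
  obtain ⟨a3, ha3⟩ : ∃ a, a = shiftedMatrix G w (f 3) := ⟨_, rfl⟩
  rw [← ha0] at x0
  rw [← ha1] at x1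
  rw [← ha2] at x2
  rw [← ha3] at x3
  have m01 : shiftedMatrix G (f 0) (f 1) = 0 := M 0 1
  have m02 : shiftedMatrix G (f 0) (f 2) = 2 := M 0 2
  have m03 : shiftedMatrix G (f 0) (f 3) = 3 := M 0 3
  have m10 : shiftedMatrix G (f 1) (f 0) = 0 := M 1 0
  have m12 : shiftedMatrix G (f 1) (f 2) = 0 := M 1 2
  have m13 : shiftedMatrix G (f 1) (f 3) = 2 := M 1 3
  have m20 : shiftedMatrix G (f 2) (f 0) = 2 := M 2 0
  have m21 : shiftedMatrix G (f 2) (f 1) = 0 := M 2 1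
  have m23 : shiftedMatrix G (f 2) (f 3) = 0 := M 2 3
  have m1 : (shiftedMatrix G).submatrix ![f 0, f 1, f 2, w] ![f 0, f 1, f 2, f 3] =
      !![1, 0, 2, 3; 0, 1, 0, 2; 2, 0, 1, 0; a0, a1, a2, a3] := by
    ext i j
    fin_cases i <;> fin_cases j <;>
      simp [shiftedMatrix_self, m01, m02, m03, m10, m12, m13, m20, m21, m23, ha0, ha1, ha2, ha3]
  have m2 : (shiftedMatrix G).submatrix ![f 0, f 1, f 2, w] ![f 0, f 1, f 2, w] =
      !![1, 0, 2, a0; 0, 1, 0, a1; 2, 0, 1, a2; a0, a1, a2, 1] := by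
    ext i j
    fin_cases i <;> fin_cases j <;>
      simp [shiftedMatrix_self, m01, m02, m10, m12, m20, m21, c0, c1, c2, ha0, ha1, ha2]
  rw [m1] at d1
  rw [m2] at d2
  clear m1 m2 hM M
  simp [Matrix.det_succ_row_zero, Fin.sum_univ_succ, Fin.succAbove] at d1 d2 x0 x1 x2 x3
  clear ha0 ha1 ha2 ha3
  -- Here a0, a3 are 0 or 3 and a1, a2 are 0 or 2. The first minor vanishes only if 2(a1 + a2) = a0
  -- + a3, which forces all four to be 0; the second minor is then -3.
  rcases x0 with rfl | rfl <;> rcases x1 with rfl | rfl <;> rcases x2 with rfl | rfl <;>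
    rcases x3 with rfl | rfl <;> omega

omit [Fintype V] [DecidableEq V] in
theorem isom_pathGraph (h : IsDiametral G f 3)
    (hw : ∀ w, w = f 0 ∨ w = f 1 ∨ w = f 2 ∨ w = f 3) : Isom G (P 4) := by
  have hadj : ∀ i j : ℕ, i < j → j ≤ 3 → (G.Adj (f i) (f j) ↔ i + 1 = j) := by
    intro i j hij hj
    rw [← SimpleGraph.dist_eq_one_iff_adj, h.dist_eq i j hij.le hj]
    omega
  have hb : Function.Bijective (fun i : Fin 4 => f i) := by
    constructor
    · intro i j hij
      by_contra hne
      rcases lt_or_gt_of_ne hne with h1 | h1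
      · exact h.ne (by simpa using h1) (by omega) hij
      · exact h.ne (by simpa using h1) (by omega) hij.symm
    · intro w
      rcases hw w with h1 | h1 | h1 | h1
      · exact ⟨0, h1.symm⟩
      · exact ⟨1, h1.symm⟩
      · exact ⟨2, h1.symm⟩
      · exact ⟨3, h1.symm⟩
  refine Isom.symm ⟨⟨Equiv.ofBijective _ hb, ?_⟩⟩
  intro i j
  simp only [Equiv.ofBijective_apply, SimpleGraph.pathGraph_adj]
  rcases lt_trichotomy i j with h1 | h1 | h1
  · rw [hadj i j (by simpa using h1) (by omega)]
    have : (i : ℕ) < j := h1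
    omega
  · subst h1; simp
  · rw [SimpleGraph.adj_comm, hadj j i (by simpa using h1) (by omega)]
    have : (j : ℕ) < i := h1
    omega

/-- The inequality D ≤ rank leaves few diameters, and each leaves two or three eccentricities in
[D/2, D]. -/
theorem shiftedRank_dichotomy (h : IsDiametral G f D) (hG : G.Connected) (hD : 3 ≤ D) :
    3 ≤ shiftedRank G ∧ (shiftedRank G = 3 → Isom G (P 4)) ∧
    (shiftedRank G = 4 → Fintype.card V ≤ 8) ∧ (shiftedRank G = 5 → Fintype.card V ≤ 15) := by
  have hr : ∀ v, 2 ≤ ecc G v := fun v => by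
    have := h.le_two_mul hG v
    omega
  have hrank := h.le_shiftedRank hr (by omega)
  have hbound : ∀ S : Finset ℕ, (∀ e, D ≤ 2 * e → e ≤ D → e ∈ S) → (∀ e ∈ S, 2 ≤ e) →
      Fintype.card V ≤ S.card * shiftedRank G := fun S hS h2 =>
    card_le_card_mul_shiftedRank S h2 fun v => hS _ (h.le_two_mul hG v) (h.ecc_le v)
  have hfive : D = 4 → 5 ≤ shiftedRank G := by
    rintro rfl
    exact h.five_le_shiftedRank hr
  refine ⟨by omega, fun hk => ?_, fun hk => ?_, fun hk => ?_⟩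
  · obtain rfl : D = 3 := by omega
    exact h.isom_pathGraph (h.eq_of_shiftedRank_le_three hr (by omega))
  -- Diameter 4 is ruled out by `hfive`.
  · obtain rfl : D = 3 := by omega
    have := hbound {2, 3} (fun e _ _ => by simp; omega) (by simp)
    simp at this
    omega
  · obtain h3 | h3 | h3 : D = 3 ∨ D = 4 ∨ D = 5 := by omega
    · have := hbound {2, 3, 4} (fun e _ _ => by simp; omega) (by simp)
      simp at this
      omega
    · have := hbound {2, 3, 4} (fun e _ _ => by simp; omega) (by simp)
      simp at this
      omega
    · have := hbound {3, 4, 5} (fun e _ _ => by simp; omega) (by simp)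
      simp at this
      omega

end IsDiametral

/-- With truncated subtraction one summand is always 0, so the sum is |i - j|. -/
theorem dist_pathGraph (n : ℕ) (i j : Fin (n + 1)) :
    (P (n + 1)).dist i j = ((i : ℕ) - j) + (j - i) := by
  have hc := SimpleGraph.pathGraph_connected n
  apply le_antisymm
  · have h : ∀ i j : Fin (n + 1), i ≤ j → (P (n + 1)).dist i j ≤ j - i := by
      intro i ⟨j, hj⟩ hij
      replace hij : (i : ℕ) ≤ j := hij
      induction j, hij using Nat.le_induction with
      | base => simp
      | succ j hij ih =>
        have h1 : (P (n + 1)).dist i ⟨j + 1, hj⟩ ≤ (P (n + 1)).dist i ⟨j, by omega⟩ +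
            (P (n + 1)).dist ⟨j, by omega⟩ ⟨j + 1, hj⟩ := hc.dist_triangle
        have h2 : (P (n + 1)).dist ⟨j, by omega⟩ ⟨j + 1, hj⟩ = 1 :=
          SimpleGraph.dist_eq_one_iff_adj.2 (SimpleGraph.pathGraph_adj.2 (Or.inl rfl))
        have h3 := ih (by omega)
        simp only at h3 ⊢
        omega
    rcases le_total i j with hij | hij
    · have := h i j hij
      omega
    · have := h j i hij
      rw [SimpleGraph.dist_comm]
      omega
  · obtain ⟨p, hp⟩ := hc.exists_walk_length_eq_dist i j
    rw [← hp]
    clear hp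
    induction p with
    | nil => simp
    | cons h p ih =>
      rw [SimpleGraph.pathGraph_adj] at h
      rw [SimpleGraph.Walk.length_cons]
      omega

/-- The matrix `A(P_4) + I`. -/
theorem shiftedMatrix_pathGraph_four :
    shiftedMatrix (P 4) = !![1, 0, 2, 3; 0, 1, 0, 2; 2, 0, 1, 0; 3, 2, 0, 1] := by
  have h1 : ∀ i, ecc (P 4) i = ![3, 2, 2, 3] i := by
    intro i
    have : (P 4).dist i = fun j : Fin 4 => ((i : ℕ) - j) + (j - i) := funext fun j => dist_pathGraph 3 i j
    rw [ecc, this]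
    clear this
    revert i
    decide
  ext i j
  rw [shiftedMatrix, of_apply, dist_pathGraph 3, h1, h1]
  fin_cases i <;> fin_cases j <;> rfl

theorem shiftedRank_pathGraph_four : shiftedRank (P 4) = 3 := by
  rw [shiftedRank]
  apply le_antisymm
  · have := rank_lt_of_det_eq_zero ((shiftedMatrix (P 4)).map (Int.cast : ℤ → ℝ)) (by
      rw [← Int.cast_det, shiftedMatrix_pathGraph_four]
      exact_mod_cast (by decide +kernel : (!![1, 0, 2, 3; 0, 1, 0, 2; 2, 0, 1, 0; 3, 2, 0, 1] :
        Matrix (Fin 4) (Fin 4) ℤ).det = 0))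
    rw [Fintype.card_fin] at this
    exact Nat.lt_succ_iff.1 this
  · have := card_le_intRank (shiftedMatrix (P 4)) ![0, 1, 2] ![0, 1, 2] (by
      rw [shiftedMatrix_pathGraph_four]
      decide +kernel)
    simpa using this

theorem shiftedMoment_pathGraph_four : shiftedMoment (P 4) 2 = 38 := by
  rw [shiftedMoment, shiftedMatrix_pathGraph_four]
  simp [Matrix.trace, pow_two, Matrix.mul_apply, Fin.sum_univ_succ]
  norm_num

end Diameter

end EccentricityMatrix

namespace EccentricityMatrix

open Matrix

/-! ### Joins K_r ∨ H and their quotient matrices. -/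

section Join

universe u v

/-- No vertex is adjacent to all others. -/
def NoUniversal {W : Type v} (H : SimpleGraph W) : Prop := ∀ v, ∃ w, w ≠ v ∧ ¬ H.Adj v w

section

variable {V : Type u} {W : Type v} {G : SimpleGraph V} {H : SimpleGraph W}

@[simp]
theorem join_adj_inl_inl (a b : V) : (join G H).Adj (Sum.inl a) (Sum.inl b) ↔ G.Adj a b := by
  simp [join]

@[simp]
theorem join_adj_inl_inr (a : V) (b : W) : (join G H).Adj (Sum.inl a) (Sum.inr b) := by
  simp [join]

@[simp]
theorem join_adj_inr_inl (a : W) (b : V) : (join G H).Adj (Sum.inr a) (Sum.inl b) := by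
  simp [join]

@[simp]
theorem join_adj_inr_inr (a b : W) : (join G H).Adj (Sum.inr a) (Sum.inr b) ↔ H.Adj a b := by
  simp [join]

theorem Isom.join {V' : Type*} {W' : Type*} {G' : SimpleGraph V'} {H' : SimpleGraph W'}
    (h : Isom G G') (h' : Isom H H') : Isom (join G H) (EccentricityMatrix.join G' H') := by
  obtain ⟨e⟩ := h
  obtain ⟨e'⟩ := h'
  refine ⟨⟨Equiv.sumCongr e.toEquiv e'.toEquiv, ?_⟩⟩
  rintro (a | a) (b | b)
  · simpa using e.map_rel_iff
  · simp
  · simp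
  · simpa using e'.map_rel_iff

theorem Isom.refl (G : SimpleGraph V) : Isom G G := ⟨SimpleGraph.Iso.refl⟩

theorem Isom.card_eq [Fintype V] [Fintype W] (h : Isom G H) : Fintype.card V = Fintype.card W := by
  obtain ⟨e⟩ := h
  exact Fintype.card_congr e.toEquiv

end

/-- K_r consists of all universal vertices and H is induced by the rest. A vertex of H misses some
vertex of G, which is then not universal either and so lies in H. -/
theorem exists_isom_join {V : Type u} [Fintype V] (G : SimpleGraph V) (u : V)
    (hu : ∀ w, w ≠ u → G.Adj u w) : ∃ (r h : ℕ) (H : SimpleGraph (Fin h)),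
      r + h = Fintype.card V ∧ 1 ≤ r ∧ NoUniversal H ∧ Isom G (join (K r) H) := by
  classical
  let p : V → Prop := fun v => ∀ w, w ≠ v → G.Adj v w
  let e1 : {v // p v} ≃ Fin (Fintype.card {v // p v}) := Fintype.equivFin _
  let e2 : {v // ¬ p v} ≃ Fin (Fintype.card {v // ¬ p v}) := Fintype.equivFin _
  refine ⟨Fintype.card {v // p v}, _, G.comap (fun i => (e2.symm i : V)), ?_, ?_, ?_, ?_⟩
  · rw [← Fintype.card_sum]
    exact Fintype.card_congr (Equiv.sumCompl p)
  · exact Fintype.card_pos_iff.2 ⟨⟨u, hu⟩⟩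
  · intro i
    have h1 := (e2.symm i).2
    simp only [p, not_forall] at h1
    obtain ⟨w, hw, hadj⟩ := h1
    have h2 : ¬ p w := fun h2 => hadj (h2 _ hw.symm).symm
    refine ⟨e2 ⟨w, h2⟩, ?_, ?_⟩
    · intro h3
      apply hw
      rw [← h3]
      simp
    · simpa using hadj
  · let e : V ≃ Fin (Fintype.card {v // p v}) ⊕ Fin (Fintype.card {v // ¬ p v}) :=
      (Equiv.sumCompl p).symm.trans (Equiv.sumCongr e1 e2)
    refine Isom.symm ⟨⟨e.symm, ?_⟩⟩
    rintro (a | a) (b | b)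
    · have := (e1.symm a).2
      simp only [e, Equiv.symm_trans_apply, Equiv.symm_symm, Equiv.sumCongr_symm, Equiv.sumCongr_apply,
        Sum.map_inl, Equiv.sumCompl_apply_inl, join_adj_inl_inl,
        SimpleGraph.top_adj]
      constructor
      · rintro h rfl
        exact G.irrefl h
      · intro h
        exact this _ fun h1 => h (e1.symm.injective (Subtype.ext h1.symm))
    · simp only [e, Equiv.symm_trans_apply, Equiv.symm_symm, Equiv.sumCongr_symm,
        Equiv.sumCongr_apply, Sum.map_inl, Sum.map_inr, Equiv.sumCompl_apply_inl,
        Equiv.sumCompl_apply_inr, join_adj_inl_inr, iff_true]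
      exact (e1.symm a).2 _ fun h => (e2.symm b).2 (h ▸ (e1.symm a).2)
    · simp only [e, Equiv.symm_trans_apply, Equiv.symm_symm, Equiv.sumCongr_symm,
        Equiv.sumCongr_apply, Sum.map_inl, Sum.map_inr, Equiv.sumCompl_apply_inl,
        Equiv.sumCompl_apply_inr, join_adj_inr_inl, iff_true]
      exact ((e1.symm b).2 _ fun h => (e2.symm a).2 (by rw [h]; exact (e1.symm b).2)).symm
    · simp [e]

variable {W : Type v} [Fintype W] [DecidableEq W] (H : SimpleGraph W)

open Classical in
/-- The Seidel matrix. -/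
noncomputable def seidelMatrix : Matrix W W ℤ :=
  of fun i j => if i = j then 0 else if H.Adj i j then -1 else 1

/-- The quotient of `A(K_r ∨ H) + I` that identifies the vertices of `K_r`. -/
noncomputable def quotientMatrix : Matrix (Unit ⊕ W) (Unit ⊕ W) ℤ :=
  fromBlocks 1 (of fun _ _ => 1) (of fun _ _ => 1) (seidelMatrix H + of fun _ _ => 1)

/-- The Schur complement of the corner entry 1 subtracts the all-ones matrix and leaves the Seidel
matrix. -/
theorem det_quotientMatrix : (quotientMatrix H).det = (seidelMatrix H).det := by
  rw [quotientMatrix, det_fromBlocks_one₁₁]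
  congr 1
  ext i j
  simp [Matrix.mul_apply]

/-- The projection onto the quotient. -/
def quotientMap (r : ℕ) : Fin r ⊕ W → Unit ⊕ W := Sum.map (fun _ => ()) id

variable {H} {r : ℕ}

omit [Fintype W] [DecidableEq W] in
theorem join_connected (hr : 1 ≤ r) : (join (K r) H).Connected := by
  have : Nonempty (Fin r ⊕ W) := ⟨Sum.inl ⟨0, hr⟩⟩
  rw [SimpleGraph.connected_iff_exists_forall_reachable]
  refine ⟨Sum.inl ⟨0, hr⟩, ?_⟩
  rintro (a | a)
  · by_cases h : (⟨0, hr⟩ : Fin r) = a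
    · rw [h]
    · exact SimpleGraph.Adj.reachable (by simpa using h)
  · exact SimpleGraph.Adj.reachable (by simp)

/-- Vertices of K_r have eccentricity at most 1 and those of H exactly 2. So pairs meeting K_r have
entry 1, and distinct vertices of H have entry 0 if adjacent and 2 if not. -/
theorem shiftedMatrix_join (hr : 1 ≤ r) (hH : NoUniversal H) :
    shiftedMatrix (join (K r) H) =
      (quotientMatrix H).submatrix (quotientMap r) (quotientMap r) := by
  have hc : (join (K r) H).Connected := join_connected hr
  have hdl : ∀ (i : Fin r) x, Sum.inl i ≠ x → (join (K r) H).dist (Sum.inl i) x = 1 := by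
    rintro i (j | j) h
    · rw [SimpleGraph.dist_eq_one_iff_adj]
      simpa using h
    · rw [SimpleGraph.dist_eq_one_iff_adj]
      simp
  have hel : ∀ (i : Fin r) x, Sum.inl i ≠ x → shiftedMatrix (join (K r) H) (Sum.inl i) x = 1 := by
    intro i x h
    have h1 := hdl i x h
    have h2 : ecc (join (K r) H) (Sum.inl i) ≤ 1 := (ecc_le_iff _ _ _).2 fun w => by
      by_cases hw : Sum.inl i = w
      · simp [← hw]
      · exact (hdl i w hw).le
    have h3 := dist_le_ecc (join (K r) H) (Sum.inl i) x
    have h4 := dist_le_ecc' (join (K r) H) (Sum.inl i) x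
    rw [shiftedMatrix_ne h, if_pos (by omega), h1, Nat.cast_one]
  have hle : ∀ x y, (join (K r) H).dist x y ≤ 2 := by
    intro x y
    have h0 : ∀ x, (join (K r) H).dist (Sum.inl ⟨0, hr⟩) x ≤ 1 := fun x => by
      by_cases hw : Sum.inl ⟨0, hr⟩ = x
      · simp [← hw]
      · exact (hdl _ x hw).le
    have h1 := h0 x
    have h2 := h0 y
    have h3 := hc.dist_triangle (u := x) (v := Sum.inl ⟨0, hr⟩) (w := y)
    rw [SimpleGraph.dist_comm (u := x) (v := Sum.inl ⟨0, hr⟩)] at h3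
    omega
  have hdr : ∀ i j : W, i ≠ j → ¬ H.Adj i j →
      (join (K r) H).dist (Sum.inr i) (Sum.inr j) = 2 := by
    intro i j hij hadj
    have h1 := hc.one_lt_dist_of_ne_of_not_adj (u := Sum.inr i) (v := Sum.inr j)
      (by simpa using hij) (by simpa using hadj)
    have h2 := hle (Sum.inr i) (Sum.inr j)
    omega
  have her : ∀ i : W, ecc (join (K r) H) (Sum.inr i) = 2 := by
    intro i
    obtain ⟨j, hj, hadj⟩ := hH i
    apply le_antisymm
    · exact (ecc_le_iff _ _ _).2 fun w => hle _ _
    · rw [← hdr i j hj.symm hadj]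
      exact dist_le_ecc _ _ _
  ext x y
  by_cases hxy : x = y
  · subst hxy
    rw [shiftedMatrix_self]
    rcases x with x | x <;> simp [quotientMap, quotientMatrix, seidelMatrix]
  · rcases x with x | x
    · rw [hel x y hxy]
      rcases y with y | y <;> simp [quotientMap, quotientMatrix]
    · rcases y with y | y
      · rw [shiftedMatrix_comm, hel y _ (Ne.symm hxy)]
        simp [quotientMap, quotientMatrix]
      · have hne : x ≠ y := fun h => hxy (by rw [h])
        rw [shiftedMatrix_ne hxy, her, her]
        by_cases h : H.Adj x y
        · rw [SimpleGraph.dist_eq_one_iff_adj.2 (by simpa using h)]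
          simp [quotientMap, quotientMatrix, seidelMatrix, hne, h]
        · rw [hdr x y hne h]
          simp [quotientMap, quotientMatrix, seidelMatrix, hne, h]

/-- One vertex of K_r together with all of H carries a full copy of the quotient matrix. -/
theorem shiftedRank_join_of_det_ne_zero (hr : 1 ≤ r) (hH : NoUniversal H)
    (hd : (seidelMatrix H).det ≠ 0) : Fintype.card W + 1 ≤ shiftedRank (join (K r) H) := by
  let g : Unit ⊕ W → Fin r ⊕ W := Sum.map (fun _ => ⟨0, hr⟩) id
  have := card_le_intRank (shiftedMatrix (join (K r) H)) g g (by
    rw [shiftedMatrix_join hr hH, Matrix.submatrix_submatrix]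
    have : quotientMap r ∘ g = id := by ext (x | x) <;> rfl
    rwa [this, Matrix.submatrix_id_id, det_quotientMatrix])
  rw [Fintype.card_sum, Fintype.card_unit] at this
  rw [shiftedRank]
  omega

theorem card_le_shiftedRank_join (hr : 1 ≤ r) (hH : NoUniversal H) :
    Fintype.card W ≤ shiftedRank (join (K r) H) := by
  refine card_le_intRank _ (Sum.inr : W → Fin r ⊕ W) Sum.inr ?_
  rw [shiftedMatrix_join hr hH]
  -- The block of H is the identity modulo 2.
  refine det_ne_zero_of_dvd _ 2 le_rfl (fun i => ?_) (fun i j hij => ?_)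
  · simp [quotientMap, quotientMatrix, seidelMatrix]
  · by_cases h : H.Adj i j <;> simp [quotientMap, quotientMatrix, seidelMatrix, hij, h]

/-- The real quotient matrix. -/
noncomputable def realQuotientMatrix (H : SimpleGraph W) : Matrix (Unit ⊕ W) (Unit ⊕ W) ℝ :=
  (quotientMatrix H).map (Int.cast : ℤ → ℝ)

theorem shiftedMatrix_join_eq_mul (hr : 1 ≤ r) (hH : NoUniversal H) :
    (shiftedMatrix (join (K r) H)).map (Int.cast : ℤ → ℝ) =
      ((1 : Matrix (Unit ⊕ W) (Unit ⊕ W) ℝ).submatrix (quotientMap r) id) *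
        (realQuotientMatrix H * (1 : Matrix (Unit ⊕ W) (Unit ⊕ W) ℝ).submatrix id (quotientMap r)) := by
  rw [shiftedMatrix_join hr hH]
  ext i j
  simp [Matrix.mul_apply, Matrix.one_apply, realQuotientMatrix]

theorem shiftedRank_join_le_rank (hr : 1 ≤ r) (hH : NoUniversal H) :
    shiftedRank (join (K r) H) ≤ (realQuotientMatrix H).rank := by
  rw [shiftedRank, intRank, shiftedMatrix_join_eq_mul hr hH]
  exact (Matrix.rank_mul_le_right _ _).trans (Matrix.rank_mul_le_left _ _)

theorem shiftedRank_join_le (hr : 1 ≤ r) (hH : NoUniversal H) :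
    shiftedRank (join (K r) H) ≤ Fintype.card W + 1 := by
  have h1 := shiftedRank_join_le_rank hr hH
  have h2 := Matrix.rank_le_card_width (realQuotientMatrix H)
  simp at h2
  omega

theorem shiftedRank_join_of_det_eq_zero (hr : 1 ≤ r) (hH : NoUniversal H)
    (hd : (seidelMatrix H).det = 0) : shiftedRank (join (K r) H) = Fintype.card W := by
  have h1 := shiftedRank_join_le_rank hr hH
  have h2 := rank_lt_of_det_eq_zero (realQuotientMatrix H) (by
    rw [realQuotientMatrix, ← Int.cast_det, det_quotientMatrix, hd, Int.cast_zero])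
  have h3 := card_le_shiftedRank_join hr hH
  simp at h2
  omega

/-- The multiplicities of the classes of the quotient. -/
def classSizes (W : Type v) (r : ℝ) : Unit ⊕ W → ℝ := Sum.elim (fun _ => r) (fun _ => 1)

/-- Write M = P Q Pᵀ with P the incidence matrix of the classes. Cyclicity of the trace replaces M
by Q PᵀP, and PᵀP = diag(r, 1, …, 1). -/
theorem shiftedMoment_join (hr : 1 ≤ r) (hH : NoUniversal H) (k : ℕ) :
    shiftedMoment (join (K r) H) (k + 1) =
      ((realQuotientMatrix H * diagonal (classSizes W r)) ^ (k + 1)).trace := by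
  have h : (1 : Matrix (Unit ⊕ W) (Unit ⊕ W) ℝ).submatrix id (quotientMap r) *
      (1 : Matrix (Unit ⊕ W) (Unit ⊕ W) ℝ).submatrix (quotientMap r) id =
        diagonal (classSizes W r) := by
    ext (i | i) (j | j) <;>
      simp [Matrix.mul_apply, Matrix.one_apply, quotientMap, classSizes, Matrix.diagonal_apply]
  rw [shiftedMoment, shiftedMatrix_join_eq_mul hr hH, trace_mul_pow_comm, Matrix.mul_assoc, h]

end Join

end EccentricityMatrix

namespace EccentricityMatrix

open Matrix

/-! ### Graphs on at most five vertices, by Boolean tables. -/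

section SmallGraphs

/-- The graph on `Fin h` with the listed edges. -/
def edgeGraph {h : ℕ} (E : List (Fin h × Fin h)) : SimpleGraph (Fin h) :=
  SimpleGraph.fromRel fun i j => (i, j) ∈ E

/-- The adjacency test of `edgeGraph E`. -/
def edgeBool {h : ℕ} (E : List (Fin h × Fin h)) (i j : Fin h) : Bool :=
  E.contains (i, j) || E.contains (j, i)

theorem edgeGraph_adj {h : ℕ} (E : List (Fin h × Fin h)) (i j : Fin h) :
    (edgeGraph E).Adj i j ↔ i ≠ j ∧ edgeBool E i j = true := by
  simp [edgeGraph, edgeBool]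

/-- The map p lists the vertices of H in the order of the model graph. Pairs i < j suffice: they
give injectivity, hence bijectivity, and both adjacencies are symmetric. -/
theorem isom_edgeGraph {h : ℕ} {H : SimpleGraph (Fin h)} {m : Fin h → Fin h → Bool}
    (hm : ∀ i j, H.Adj i j ↔ m i j = true) (E : List (Fin h × Fin h)) (p : Fin h → Fin h)
    (hp : ∀ i j, i < j → p i ≠ p j ∧ m (p i) (p j) = edgeBool E i j) :
    Isom H (edgeGraph E) := by
  have hinj : Function.Injective p := by
    intro i j hij
    by_contra hne
    rcases lt_or_gt_of_ne hne with h1 | h1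
    · exact (hp i j h1).1 hij
    · exact (hp j i h1).1 hij.symm
  refine Isom.symm ⟨⟨Equiv.ofBijective p (Finite.injective_iff_bijective.1 hinj), ?_⟩⟩
  intro i j
  rw [edgeGraph_adj, Equiv.ofBijective_apply, Equiv.ofBijective_apply]
  rcases lt_trichotomy i j with h1 | h1 | h1
  · rw [hm, (hp i j h1).2]
    simp [h1.ne]
  · simp [h1]
  · rw [SimpleGraph.adj_comm, hm, (hp j i h1).2]
    simp [h1.ne', edgeBool, or_comm]

/-- The Seidel matrix of a Boolean adjacency table. -/
def seidelTable {h : ℕ} (m : Fin h → Fin h → Bool) : Matrix (Fin h) (Fin h) ℤ :=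
  of fun i j => if i = j then 0 else if m i j then -1 else 1

theorem seidelMatrix_eq_seidelTable {h : ℕ} {H : SimpleGraph (Fin h)} {m : Fin h → Fin h → Bool}
    (hm : ∀ i j, H.Adj i j ↔ m i j = true) : seidelMatrix H = seidelTable m := by
  ext i j
  simp [seidelMatrix, seidelTable, hm]

theorem noUniversal_iff {h : ℕ} {H : SimpleGraph (Fin h)} {m : Fin h → Fin h → Bool}
    (hm : ∀ i j, H.Adj i j ↔ m i j = true) :
    NoUniversal H ↔ ∀ i, ∃ j, j ≠ i ∧ m i j = false := by
  simp [NoUniversal, hm]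

/-- Symmetric Boolean tables of order three. -/
def tableThree (a b c : Bool) : Fin 3 → Fin 3 → Bool
  | 0, 1 => a | 1, 0 => a | 0, 2 => b | 2, 0 => b | 1, 2 => c | 2, 1 => c
  | _, _ => false

/-- Symmetric Boolean tables of order four. -/
def tableFour (a b c d e f : Bool) : Fin 4 → Fin 4 → Bool
  | 0, 1 => a | 1, 0 => a | 0, 2 => b | 2, 0 => b | 0, 3 => c | 3, 0 => c
  | 1, 2 => d | 2, 1 => d | 1, 3 => e | 3, 1 => e | 2, 3 => f | 3, 2 => f
  | _, _ => false

/-- Symmetric Boolean tables of order five. -/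
def tableFive (a b c d e f g h i j : Bool) : Fin 5 → Fin 5 → Bool
  | 0, 1 => a | 1, 0 => a
  | 0, 2 => b | 2, 0 => b
  | 0, 3 => c | 3, 0 => c
  | 0, 4 => d | 4, 0 => d
  | 1, 2 => e | 2, 1 => e
  | 1, 3 => f | 3, 1 => f
  | 1, 4 => g | 4, 1 => g
  | 2, 3 => h | 3, 2 => h
  | 2, 4 => i | 4, 2 => i
  | 3, 4 => j | 4, 3 => j
  | _, _ => false

theorem exists_tableThree (H : SimpleGraph (Fin 3)) :
    ∃ a b c, ∀ i j, H.Adj i j ↔ tableThree a b c i j = true := by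
  classical
  refine ⟨decide (H.Adj 0 1), decide (H.Adj 0 2), decide (H.Adj 1 2), fun i j => ?_⟩
  fin_cases i <;> fin_cases j <;> simp [tableThree, SimpleGraph.adj_comm] <;>
    exact H.adj_comm _ _

theorem exists_tableFour (H : SimpleGraph (Fin 4)) :
    ∃ a b c d e f, ∀ i j, H.Adj i j ↔ tableFour a b c d e f i j = true := by
  classical
  refine ⟨decide (H.Adj 0 1), decide (H.Adj 0 2), decide (H.Adj 0 3), decide (H.Adj 1 2),
    decide (H.Adj 1 3), decide (H.Adj 2 3), fun i j => ?_⟩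
  fin_cases i <;> fin_cases j <;> simp [tableFour, SimpleGraph.adj_comm] <;>
    exact H.adj_comm _ _

theorem exists_tableFive (H : SimpleGraph (Fin 5)) :
    ∃ a b c d e f g h k l, ∀ i j, H.Adj i j ↔ tableFive a b c d e f g h k l i j = true := by
  classical
  refine ⟨decide (H.Adj 0 1), decide (H.Adj 0 2), decide (H.Adj 0 3), decide (H.Adj 0 4),
    decide (H.Adj 1 2), decide (H.Adj 1 3), decide (H.Adj 1 4), decide (H.Adj 2 3),
    decide (H.Adj 2 4), decide (H.Adj 3 4), fun i j => ?_⟩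
  fin_cases i <;> fin_cases j <;> simp [tableFive, SimpleGraph.adj_comm] <;>
    exact H.adj_comm _ _

/-- In orders two and three the Seidel determinant is -1 and ±2. In order four it is odd, since S is
J - I modulo 2 and det(J - I) = -3. Order five is the first order above one in which it can vanish.
-/
theorem det_seidelMatrix_fin_two (H : SimpleGraph (Fin 2)) : (seidelMatrix H).det ≠ 0 := by
  rw [det_fin_two]
  by_cases h : H.Adj 0 1 <;> simp [seidelMatrix, h, SimpleGraph.adj_comm (u := (1 : Fin 2))]

theorem det_seidelMatrix_fin_three (H : SimpleGraph (Fin 3)) : (seidelMatrix H).det ≠ 0 := by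
  obtain ⟨a, b, c, hm⟩ := exists_tableThree H
  rw [seidelMatrix_eq_seidelTable hm]
  revert a b c
  have : ∀ a b c, (seidelTable (tableThree a b c)).det ≠ 0 := by decide +kernel
  exact fun a b c _ => this a b c

theorem det_seidelMatrix_fin_four (H : SimpleGraph (Fin 4)) : (seidelMatrix H).det ≠ 0 := by
  obtain ⟨a, b, c, d, e, f, hm⟩ := exists_tableFour H
  rw [seidelMatrix_eq_seidelTable hm]
  have : ∀ a b c d e f, (seidelTable (tableFour a b c d e f)).det ≠ 0 := by decide +kernel
  exact this a b c d e f

theorem eq_bot_of_noUniversal_fin_two (H : SimpleGraph (Fin 2)) (hH : NoUniversal H) : H = ⊥ := by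
  have h01 : ¬ H.Adj 0 1 := by
    obtain ⟨w, hw, h⟩ := hH 0
    fin_cases w
    · simp at hw
    · exact h
  ext i j
  fin_cases i <;> fin_cases j <;> simp [h01, SimpleGraph.adj_comm (u := (1 : Fin 2))]

/-- The graphs `K_2 ∪ K_1` and `3 K_1`. -/
def edgeListsThree : List (List (Fin 3 × Fin 3)) := [[(0, 1)], []]

/-- The graphs of order four without universal vertices. -/
def edgeListsFour : List (List (Fin 4 × Fin 4)) :=
  [[], [(2, 3)], [(0, 1), (1, 2)], [(0, 1), (2, 3)], [(0, 1), (1, 2), (2, 3)],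
    [(0, 1), (1, 2), (0, 2)], [(0, 1), (1, 2), (2, 3), (0, 3)]]

/-- The graphs `C_5`, `K_1 ∪ P_4` and the bull. -/
def edgeListsFive : List (List (Fin 5 × Fin 5)) :=
  [[(0, 1), (1, 2), (2, 3), (3, 4), (0, 4)], [(1, 2), (2, 3), (3, 4)],
    [(0, 1), (1, 2), (2, 3), (4, 1), (4, 2)]]

theorem isom_of_noUniversal_fin_three (H : SimpleGraph (Fin 3)) (hH : NoUniversal H) :
    ∃ E ∈ edgeListsThree, Isom H (edgeGraph E) := by
  obtain ⟨a, b, c, hm⟩ := exists_tableThree H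
  have h1 : ∀ a b c : Bool, (∀ i, ∃ j, j ≠ i ∧ tableThree a b c i j = false) →
      ∃ E ∈ edgeListsThree, ∃ p0 p1, p0 ≠ p1 ∧ tableThree a b c p0 p1 = edgeBool E 0 1 ∧
      ∃ p2, p0 ≠ p2 ∧ p1 ≠ p2 ∧ tableThree a b c p0 p2 = edgeBool E 0 2 ∧
      tableThree a b c p1 p2 = edgeBool E 1 2 := by
    decide +kernel
  obtain ⟨E, hE, p0, p1, h01, t01, p2, h02, h12, t02, t12⟩ := h1 a b c ((noUniversal_iff hm).1 hH)
  refine ⟨E, hE, isom_edgeGraph hm E ![p0, p1, p2] fun i j hij => ?_⟩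
  fin_cases i <;> fin_cases j <;> first | exact absurd hij (by decide) | exact ⟨‹_›, ‹_›⟩

theorem isom_of_noUniversal_fin_four (H : SimpleGraph (Fin 4)) (hH : NoUniversal H) :
    ∃ E ∈ edgeListsFour, Isom H (edgeGraph E) := by
  obtain ⟨a, b, c, d, e, f, hm⟩ := exists_tableFour H
  -- The conditions are interleaved with the existentials so that a bad partial relabelling is
  -- rejected before the next vertex is chosen.
  have h1 : ∀ a b c d e f : Bool, (∀ i, ∃ j, j ≠ i ∧ tableFour a b c d e f i j = false) →
      ∃ E ∈ edgeListsFour, ∃ p0 p1, p0 ≠ p1 ∧ tableFour a b c d e f p0 p1 = edgeBool E 0 1 ∧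
      ∃ p2, p0 ≠ p2 ∧ p1 ≠ p2 ∧ tableFour a b c d e f p0 p2 = edgeBool E 0 2 ∧
      tableFour a b c d e f p1 p2 = edgeBool E 1 2 ∧
      ∃ p3, p0 ≠ p3 ∧ p1 ≠ p3 ∧ p2 ≠ p3 ∧ tableFour a b c d e f p0 p3 = edgeBool E 0 3 ∧
      tableFour a b c d e f p1 p3 = edgeBool E 1 3 ∧
      tableFour a b c d e f p2 p3 = edgeBool E 2 3 := by
    decide +kernel
  obtain ⟨E, hE, p0, p1, h01, t01, p2, h02, h12, t02, t12, p3, h03, h13, h23, t03, t13, t23⟩ :=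
    h1 a b c d e f ((noUniversal_iff hm).1 hH)
  refine ⟨E, hE, isom_edgeGraph hm E ![p0, p1, p2, p3] fun i j hij => ?_⟩
  fin_cases i <;> fin_cases j <;> first | exact absurd hij (by decide) | exact ⟨‹_›, ‹_›⟩

/-- The determinant of a symmetric matrix of order five with zero diagonal. -/
def hollowDet (a b c d e f g h i j : ℤ) : ℤ :=
  2 * (a * b * f * i * j + a * b * g * h * j + a * c * e * i * j + a * c * g * h * i + a * d
    * e * h * j + a * d * f * h * i + b * c * e * g * j + b * c * f * g * i + b * d * e *
    f * j + b * d * f * g * h + c * d * e * f * i + c * d * e * g * h -    a * b * e * j ^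
    2 - a * c * f * i ^ 2 - a * d * g * h ^ 2 - b * c * h * g ^ 2 - b * d * i * f ^ 2 - c
    * d * j * e ^ 2 - e * f * h * d ^ 2 - e * g * i * c ^ 2 - f * g * j * b ^ 2 - h * i *
    j * a ^ 2)

/-- Zero diagonal leaves only derangements: 24 five-cycles with sign + and 20 products of a 3-cycle
and a transposition with sign -. Pairing each with its inverse gives the factor 2. The closed form
keeps the check of 1024 tables cheap. -/
theorem det_hollow (a b c d e f g h i j : ℤ) :
    (!![0, a, b, c, d; a, 0, e, f, g; b, e, 0, h, i; c, f, h, 0, j; d, g, i, j, 0] :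
      Matrix (Fin 5) (Fin 5) ℤ).det = hollowDet a b c d e f g h i j := by
  simp [Matrix.det_succ_row_zero, Fin.sum_univ_succ, Fin.succAbove, hollowDet]
  ring

/-- The Seidel sign of a possible edge. -/
def sign (a : Bool) : ℤ := if a then -1 else 1

theorem isom_of_noUniversal_fin_five (H : SimpleGraph (Fin 5)) (hH : NoUniversal H)
    (hd : (seidelMatrix H).det = 0) : ∃ E ∈ edgeListsFive, Isom H (edgeGraph E) := by
  obtain ⟨a, b, c, d, e, f, g, h, i, j, hm⟩ := exists_tableFive H
  have h0 : hollowDet (sign a) (sign b) (sign c) (sign d) (sign e) (sign f) (sign g) (sign h)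
      (sign i) (sign j) = 0 := by
    rw [← hd, seidelMatrix_eq_seidelTable hm, ← det_hollow]
    congr 1
    ext x y
    fin_cases x <;> fin_cases y <;> rfl
  have h1 : ∀ a b c d e f g h i j : Bool,
      (∀ x, ∃ y, y ≠ x ∧ tableFive a b c d e f g h i j x y = false) →
      hollowDet (sign a) (sign b) (sign c) (sign d) (sign e) (sign f) (sign g) (sign h)
        (sign i) (sign j) = 0 →
      ∃ E ∈ edgeListsFive, ∃ p0 p1, p0 ≠ p1 ∧
      tableFive a b c d e f g h i j p0 p1 = edgeBool E 0 1 ∧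
      ∃ p2, p0 ≠ p2 ∧ p1 ≠ p2 ∧ tableFive a b c d e f g h i j p0 p2 = edgeBool E 0 2 ∧
      tableFive a b c d e f g h i j p1 p2 = edgeBool E 1 2 ∧
      ∃ p3, p0 ≠ p3 ∧ p1 ≠ p3 ∧ p2 ≠ p3 ∧
      tableFive a b c d e f g h i j p0 p3 = edgeBool E 0 3 ∧
      tableFive a b c d e f g h i j p1 p3 = edgeBool E 1 3 ∧
      tableFive a b c d e f g h i j p2 p3 = edgeBool E 2 3 ∧
      ∃ p4, p0 ≠ p4 ∧ p1 ≠ p4 ∧ p2 ≠ p4 ∧ p3 ≠ p4 ∧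
      tableFive a b c d e f g h i j p0 p4 = edgeBool E 0 4 ∧
      tableFive a b c d e f g h i j p1 p4 = edgeBool E 1 4 ∧
      tableFive a b c d e f g h i j p2 p4 = edgeBool E 2 4 ∧
      tableFive a b c d e f g h i j p3 p4 = edgeBool E 3 4 := by
    decide +kernel
  obtain ⟨E, hE, p0, p1, h01, t01, p2, h02, h12, t02, t12, p3, h03, h13, h23, t03, t13, t23,
    p4, h04, h14, h24, h34, t04, t14, t24, t34⟩ :=
    h1 a b c d e f g h i j ((noUniversal_iff hm).1 hH) h0
  refine ⟨E, hE, isom_edgeGraph hm E ![p0, p1, p2, p3, p4] fun x y hxy => ?_⟩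
  fin_cases x <;> fin_cases y <;> first | exact absurd hxy (by decide) | exact ⟨‹_›, ‹_›⟩

theorem det_seidelMatrix_edgeListsFive (E) (hE : E ∈ edgeListsFive) :
    (seidelMatrix (edgeGraph E)).det = 0 := by
  have hm : ∀ i j, (edgeGraph E).Adj i j ↔ (decide (i ≠ j) && edgeBool E i j) = true := by
    intro i j
    rw [edgeGraph_adj]
    simp
  rw [seidelMatrix_eq_seidelTable hm]
  revert E
  have : ∀ E ∈ edgeListsFive,
      (seidelTable fun i j => decide (i ≠ j) && edgeBool E i j).det = 0 := by
    decide +kernel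
  exact fun E hE _ => this E hE

theorem noUniversal_edgeGraph {h : ℕ} (E : List (Fin h × Fin h))
    (hE : ∀ i, ∃ j, j ≠ i ∧ edgeBool E i j = false) : NoUniversal (edgeGraph E) := by
  intro i
  obtain ⟨j, hj, h⟩ := hE i
  exact ⟨j, hj, by simp [edgeGraph_adj, h]⟩

end SmallGraphs

end EccentricityMatrix

namespace EccentricityMatrix

open Matrix

/-! ### Traces of powers of the weighted quotient. -/

section Moments

variable {W : Type*} [Fintype W] [DecidableEq W]

theorem realQuotientMatrix_mul_diagonal (H : SimpleGraph W) (r : ℝ) :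
    realQuotientMatrix H * diagonal (classSizes W r) = fromBlocks (of fun _ _ => r) (of fun _ _ => 1)
      (of fun _ _ => r) ((seidelMatrix H + of fun _ _ => 1).map (Int.cast : ℤ → ℝ)) := by
  ext (i | i) (j | j) <;> simp [realQuotientMatrix, quotientMatrix, classSizes]

/-- This trace and the next two count weighted closed walks in the quotient, sorted by their visits
to the collapsed clique; each visit contributes a factor r. -/
theorem trace_fromBlocks_pow_two (B : Matrix W W ℝ) (r : ℝ) :
    ((fromBlocks (of fun (_ _ : Unit) => r) (of fun _ _ => 1) (of fun _ _ => r) B) ^ 2).trace =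
    r ^ 2 + 2 * r * Fintype.card W + (B * B).trace := by
  simp only [pow_two, fromBlocks_multiply]
  simp [trace, mul_apply, Finset.sum_add_distrib]
  ring

theorem trace_fromBlocks_pow_three (B : Matrix W W ℝ) (r : ℝ) :
    ((fromBlocks (of fun (_ _ : Unit) => r) (of fun _ _ => 1) (of fun _ _ => r) B) ^ 3).trace =
    r ^ 3 + 3 * r ^ 2 * Fintype.card W + 3 * r * ∑ i, ∑ j, B i j + (B * B * B).trace := by
  simp only [pow_succ, pow_zero, one_mul, fromBlocks_multiply, Matrix.add_mul]
  simp [trace, mul_apply, Finset.sum_add_distrib, ← Finset.mul_sum, ← Finset.sum_mul]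
  rw [Finset.sum_comm (f := fun y x => B y x)]
  ring

theorem trace_fromBlocks_pow_four (B : Matrix W W ℝ) (r : ℝ) :
    ((fromBlocks (of fun (_ _ : Unit) => r) (of fun _ _ => 1) (of fun _ _ => r) B) ^ 4).trace =
    r ^ 4 + 4 * r ^ 3 * Fintype.card W + 4 * r ^ 2 * (∑ i, ∑ j, B i j) + 2 * r ^ 2 * Fintype.card W ^ 2
      + 4 * r * (∑ i, ∑ j, (B * B) i j) + (B * B * B * B).trace := by
  simp only [pow_succ, pow_zero, one_mul, fromBlocks_multiply, Matrix.add_mul]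
  simp [trace, mul_apply, Finset.sum_add_distrib, ← Finset.mul_sum, ← Finset.sum_mul]
  -- The sum of the entries of B² appears in several forms; all are brought to the sum over x of
  -- (column sum) times (row sum).
  have e0 : ∑ i, ∑ j, B j i = ∑ i, ∑ j, B i j := Finset.sum_comm
  have e1 : ∑ i, ∑ x, (∑ j, B j x) * B x i = ∑ x, (∑ j, B j x) * ∑ i, B x i := by
    rw [Finset.sum_comm]
    simp [Finset.mul_sum]
  have e2 : ∑ x, (∑ i, B x i) * r * ∑ i, B i x = r * ∑ x, (∑ j, B j x) * ∑ i, B x i := by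
    rw [Finset.mul_sum]
    exact Finset.sum_congr rfl fun x _ => by ring
  have e3 : ∑ i, ∑ x, (r * ∑ j, B j x) * B x i = r * ∑ x, (∑ j, B j x) * ∑ i, B x i := by
    rw [← e1]
    simp only [← Finset.mul_sum, mul_assoc]
  have e4 : ∑ i, ∑ j, ∑ x, B i x * B x j = ∑ x, (∑ j, B j x) * ∑ i, B x i := by
    rw [← e1]
    simp only [Finset.sum_mul]
    rw [Finset.sum_comm]
    exact Finset.sum_congr rfl fun i _ => Finset.sum_comm
  rw [e0, e1, e2, e3, e4]
  ring

end Moments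

/-! ### Separating the joins by their moments. -/

section EdgeLists

variable {h : ℕ} (E : List (Fin h × Fin h))

/-- The block of the quotient matrix belonging to `edgeGraph E`. -/
def edgeMatrix : Matrix (Fin h) (Fin h) ℤ :=
  of fun i j => if i = j then 1 else if edgeBool E i j then 0 else 2

theorem seidelMatrix_add_eq_edgeMatrix :
    (seidelMatrix (edgeGraph E) + of fun _ _ => 1) = edgeMatrix E := by
  ext i j
  by_cases h1 : i = j
  · simp [seidelMatrix, edgeMatrix, h1]
  · by_cases h2 : edgeBool E i j = true <;> simp [seidelMatrix, edgeMatrix, h1, h2, edgeGraph_adj]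

/-- The sum of the entries of `edgeMatrix E`. -/
def entrySum : ℤ := ∑ i, ∑ j, edgeMatrix E i j

/-- The sum of the entries of the square of `edgeMatrix E`. -/
def squareEntrySum : ℤ := ∑ i, ∑ j, (edgeMatrix E * edgeMatrix E) i j

/-- The trace of the square of `edgeMatrix E`. -/
def traceTwo : ℤ := (edgeMatrix E * edgeMatrix E).trace

/-- The trace of the cube of `edgeMatrix E`. -/
def traceThree : ℤ := (edgeMatrix E * edgeMatrix E * edgeMatrix E).trace

/-- The trace of the fourth power of `edgeMatrix E`. -/
def traceFour : ℤ := (edgeMatrix E * edgeMatrix E * edgeMatrix E * edgeMatrix E).trace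

theorem trace_intCast (A : Matrix (Fin h) (Fin h) ℤ) :
    (A.map (Int.cast : ℤ → ℝ)).trace = ((A.trace : ℤ) : ℝ) := by
  simp [trace]

theorem mul_intCast (A B : Matrix (Fin h) (Fin h) ℤ) :
    A.map (Int.cast : ℤ → ℝ) * B.map (Int.cast : ℤ → ℝ) = (A * B).map (Int.cast : ℤ → ℝ) :=
  (Matrix.map_mul_intCast A B).symm

variable {E} {r : ℕ}

theorem shiftedMoment_two (hr : 1 ≤ r) (hE : NoUniversal (edgeGraph E)) :
    shiftedMoment (join (K r) (edgeGraph E)) 2 =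
      (((r : ℤ) ^ 2 + 2 * r * h + traceTwo E : ℤ) : ℝ) := by
  rw [shiftedMoment_join hr hE 1, realQuotientMatrix_mul_diagonal, seidelMatrix_add_eq_edgeMatrix,
    trace_fromBlocks_pow_two, mul_intCast, trace_intCast, Fintype.card_fin, traceTwo]
  push_cast
  ring

theorem shiftedMoment_three (hr : 1 ≤ r) (hE : NoUniversal (edgeGraph E)) :
    shiftedMoment (join (K r) (edgeGraph E)) 3 =
      (((r : ℤ) ^ 3 + 3 * r ^ 2 * h + 3 * r * entrySum E + traceThree E : ℤ) : ℝ) := by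
  rw [shiftedMoment_join hr hE 2, realQuotientMatrix_mul_diagonal, seidelMatrix_add_eq_edgeMatrix,
    trace_fromBlocks_pow_three, mul_intCast, mul_intCast, trace_intCast, Fintype.card_fin,
    traceThree, entrySum]
  push_cast
  simp

theorem shiftedMoment_four (hr : 1 ≤ r) (hE : NoUniversal (edgeGraph E)) :
    shiftedMoment (join (K r) (edgeGraph E)) 4 =
      (((r : ℤ) ^ 4 + 4 * r ^ 3 * h + 4 * r ^ 2 * entrySum E + 2 * r ^ 2 * h ^ 2 +
        4 * r * squareEntrySum E + traceFour E : ℤ) : ℝ) := by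
  rw [shiftedMoment_join hr hE 3, realQuotientMatrix_mul_diagonal, seidelMatrix_add_eq_edgeMatrix,
    trace_fromBlocks_pow_four, mul_intCast, mul_intCast, mul_intCast, trace_intCast,
    Fintype.card_fin, traceFour, entrySum, squareEntrySum]
  push_cast
  simp

/-- A numerical condition on `E` and `E'` under which the moments of the joins of `K_r` with the
corresponding graphs distinguish them. -/
def SeparatedByMoments (E E' : List (Fin h × Fin h)) : Prop :=
  traceTwo E = traceTwo E' → entrySum E = entrySum E' ∧ (traceThree E = traceThree E' → E = E' ∨
    (squareEntrySum E < squareEntrySum E' ∧ traceFour E < traceFour E') ∨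
    (squareEntrySum E' < squareEntrySum E ∧ traceFour E' < traceFour E))

instance (E E' : List (Fin h × Fin h)) : Decidable (SeparatedByMoments E E') := by
  unfold SeparatedByMoments; infer_instance

/-- For fixed r and h the second moment fixes `traceTwo`, that is, the number of non-edges and with
it `entrySum`; the third then fixes `traceThree`. If these agree for distinct lists, the fourth
moments differ by 4r times the difference of `squareEntrySum` plus that of `traceFour`. Both
differences have the same strict sign, so no r makes them cancel. -/
theorem eq_of_shiftedMoment_eq {E E' : List (Fin h × Fin h)} (hr : 1 ≤ r)
    (hE : NoUniversal (edgeGraph E)) (hE' : NoUniversal (edgeGraph E'))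
    (hs : SeparatedByMoments E E')
    (hm : ∀ k, shiftedMoment (join (K r) (edgeGraph E)) k =
      shiftedMoment (join (K r) (edgeGraph E')) k) : E = E' := by
  have h2 := hm 2
  have h3 := hm 3
  have h4 := hm 4
  rw [shiftedMoment_two hr hE, shiftedMoment_two hr hE', Int.cast_inj] at h2
  rw [shiftedMoment_three hr hE, shiftedMoment_three hr hE', Int.cast_inj] at h3
  rw [shiftedMoment_four hr hE, shiftedMoment_four hr hE', Int.cast_inj] at h4
  obtain ⟨h5, h6⟩ := hs (by linarith)
  rw [h5] at h3 h4
  have hr' : (1 : ℤ) ≤ r := by exact_mod_cast hr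
  rcases h6 (by linarith) with h7 | ⟨h7, h8⟩ | ⟨h7, h8⟩
  · exact h7
  · nlinarith
  · nlinarith

theorem separatedByMoments_edgeListsThree :
    ∀ E ∈ edgeListsThree, ∀ E' ∈ edgeListsThree, SeparatedByMoments E E' := by
  decide +kernel

theorem separatedByMoments_edgeListsFour :
    ∀ E ∈ edgeListsFour, ∀ E' ∈ edgeListsFour, SeparatedByMoments E E' := by
  decide +kernel

theorem separatedByMoments_edgeListsFive :
    ∀ E ∈ edgeListsFive, ∀ E' ∈ edgeListsFive, SeparatedByMoments E E' := by
  decide +kernel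

theorem noUniversal_edgeListsThree (E) (hE : E ∈ edgeListsThree) : NoUniversal (edgeGraph E) :=
  noUniversal_edgeGraph E ((by decide +kernel :
    ∀ E ∈ edgeListsThree, ∀ i, ∃ j, j ≠ i ∧ edgeBool E i j = false) E hE)

theorem noUniversal_edgeListsFour (E) (hE : E ∈ edgeListsFour) : NoUniversal (edgeGraph E) :=
  noUniversal_edgeGraph E ((by decide +kernel :
    ∀ E ∈ edgeListsFour, ∀ i, ∃ j, j ≠ i ∧ edgeBool E i j = false) E hE)

theorem noUniversal_edgeListsFive (E) (hE : E ∈ edgeListsFive) : NoUniversal (edgeGraph E) :=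
  noUniversal_edgeGraph E ((by decide +kernel :
    ∀ E ∈ edgeListsFive, ∀ i, ∃ j, j ≠ i ∧ edgeBool E i j = false) E hE)

theorem shiftedMoment_four_vertices_ne_five_vertices (hr : 1 ≤ r) (E) (hE : E ∈ edgeListsFour) (E')
    (hE' : E' ∈ edgeListsFive) : ¬ ∀ k, shiftedMoment (join (K (r + 1)) (edgeGraph E)) k =
      shiftedMoment (join (K r) (edgeGraph E')) k := by
  intro hm
  have h2 := hm 2
  have h3 := hm 3
  have n1 := noUniversal_edgeListsFour E hE
  have n2 := noUniversal_edgeListsFive E' hE'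
  rw [shiftedMoment_two (by omega) n1, shiftedMoment_two hr n2, Int.cast_inj] at h2
  rw [shiftedMoment_three (by omega) n1, shiftedMoment_three hr n2, Int.cast_inj] at h3
  -- Equality of second moments reduces to the hypothesis, free of r. The difference of third
  -- moments is then linear in r, and the two conclusions say that its slope is positive and its
  -- constant term nonnegative.
  have key : ∀ E ∈ edgeListsFour, ∀ E' ∈ edgeListsFive, 9 + traceTwo E = traceTwo E' →
      0 < 27 + 3 * entrySum E - 3 * entrySum E' ∧
        0 ≤ 13 + 3 * entrySum E + traceThree E - traceThree E' := by
    decide +kernel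
  push_cast at h2 h3
  obtain ⟨h4, h5⟩ := key E hE E' hE' (by linarith)
  have hr' : (1 : ℤ) ≤ r := by exact_mod_cast hr
  nlinarith

end EdgeLists

end EccentricityMatrix

namespace EccentricityMatrix

open Matrix

/-! ### Classification by rank and spectral determination. -/

section Families

universe u v

variable {V : Type u} [Fintype V] [DecidableEq V] {G : SimpleGraph V}

/-- Diameter 2 remains besides the dichotomy for D ≥ 3. There every eccentricity is 2, so the single
class bounds n by the rank. Rank 3 then allows n = 3, hence the extra alternative. -/
theorem shiftedRank_of_forall_exists_not_adj (hG : G.Connected)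
    (hu : ∀ u, ∃ w, w ≠ u ∧ ¬ G.Adj u w) :
    3 ≤ shiftedRank G ∧ (shiftedRank G = 3 → Isom G (P 4) ∨ Fintype.card V ≤ 3) ∧
    (shiftedRank G = 4 → Fintype.card V ≤ 8) ∧ (shiftedRank G = 5 → Fintype.card V ≤ 15) := by
  obtain ⟨f, D, h⟩ := exists_isDiametral hG
  have hr : ∀ v, 2 ≤ ecc G v := by
    intro v
    obtain ⟨w, hw, hadj⟩ := hu v
    exact (hG.one_lt_dist_of_ne_of_not_adj hw.symm hadj).trans_le (dist_le_ecc G v w)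
  have hD : 2 ≤ D := (hr (f 0)).trans (h.ecc_le _)
  rcases Nat.lt_or_ge 2 D with h3 | h3
  · obtain ⟨h4, h5, h6⟩ := h.shiftedRank_dichotomy hG h3
    exact ⟨h4, fun h7 => Or.inl (h5 h7), h6⟩
  · obtain rfl : D = 2 := by omega
    have h1 := card_le_card_mul_shiftedRank (G := G) {2} (by simp) fun v => by
      have := hr v
      have := h.ecc_le v
      simp
      omega
    have h2 : 2 < Fintype.card V := Fintype.two_lt_card_iff.2
      ⟨f 0, f 1, f 2, h.ne (by omega) (by omega), h.ne (by omega) (by omega),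
        h.ne (by omega) (by omega)⟩
    simp at h1
    refine ⟨by omega, fun h => Or.inr (by omega), by omega, by omega⟩

/-- One vertex alone would be universal in H, so h = 1 is impossible; this is why rank 2 never
occurs. -/
theorem shiftedRank_join_fin {r h : ℕ} {H : SimpleGraph (Fin h)} (hr : 1 ≤ r)
    (hH : NoUniversal H) : h ≠ 1 ∧ h ≤ shiftedRank (join (K r) H) ∧
      shiftedRank (join (K r) H) ≤ h + 1 ∧ (h ≤ 4 → shiftedRank (join (K r) H) = h + 1) ∧
      (h = 5 → shiftedRank (join (K r) H) = 5 → (seidelMatrix H).det = 0) := by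
  have h1 := card_le_shiftedRank_join hr hH
  have h2 := shiftedRank_join_le hr hH
  have h3 := shiftedRank_join_of_det_ne_zero hr hH
  rw [Fintype.card_fin] at h1 h2 h3
  have h4 : h ≠ 1 := by
    rintro rfl
    obtain ⟨w, hw, -⟩ := hH 0
    exact hw (Subsingleton.elim _ _)
  refine ⟨h4, h1, h2, fun h5 => le_antisymm h2 (h3 ?_), fun h5 h6 => ?_⟩
  · interval_cases h
    · simp
    · exact absurd rfl h4
    · exact det_seidelMatrix_fin_two H
    · exact det_seidelMatrix_fin_three H
    · exact det_seidelMatrix_fin_four H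
  · by_contra h7
    have := h3 h7
    omega

omit [Fintype V] [DecidableEq V] in
theorem isom_join_fin_zero (n : ℕ) (H : SimpleGraph (Fin 0)) :
    Isom G (join (K n) H) ↔ Isom G (K n) := by
  have : Isom (join (K n) H) (K n) := by
    refine ⟨⟨Equiv.sumEmpty _ _, ?_⟩⟩
    rintro (a | a) (b | b)
    · simp
    all_goals first | exact a.elim0 | exact b.elim0
  exact ⟨fun h => h.trans this, fun h => h.trans this.symm⟩

theorem exists_shiftedRank_eq (hG : G.Connected) {n : ℕ} (hn : Fintype.card V = n)
    (hu : ∃ u, ∀ w, w ≠ u → G.Adj u w) : ∃ (h : ℕ) (H : SimpleGraph (Fin h)), h < n ∧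
      NoUniversal H ∧ Isom G (join (K (n - h)) H) ∧
      shiftedRank G = shiftedRank (join (K (n - h)) H) := by
  obtain ⟨u, hu⟩ := hu
  obtain ⟨r, h, H, hc, hr, hH, hi⟩ := exists_isom_join G u hu
  obtain rfl : r = n - h := by omega
  exact ⟨h, H, by omega, hH, hi, shiftedRank_iso hG hi⟩

theorem dichotomy (G : SimpleGraph V) : (∃ u, ∀ w, w ≠ u → G.Adj u w) ∨
    (∀ u, ∃ w, w ≠ u ∧ ¬ G.Adj u w) := by
  by_cases h : ∃ u, ∀ w, w ≠ u → G.Adj u w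
  · exact Or.inl h
  · right
    push Not at h
    exact h

theorem shiftedRank_eq_one_iff (hG : G.Connected) {n : ℕ} (hn : Fintype.card V = n) :
    shiftedRank G = 1 ↔ Isom G (K n) := by
  constructor
  · intro hk
    rcases dichotomy G with hu | hu
    · obtain ⟨h, H, hlt, hH, hi, he⟩ := exists_shiftedRank_eq hG hn hu
      obtain ⟨h1, h2, h3, h4, h5⟩ := shiftedRank_join_fin (r := n - h) (by omega) hH
      obtain rfl : h = 0 := by omega
      exact (isom_join_fin_zero n H).1 hi
    · have := (shiftedRank_of_forall_exists_not_adj hG hu).1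
      omega
  · intro hi
    have hpos : 1 ≤ n := by
      have := hG.nonempty
      rw [← hn]
      exact Fintype.card_pos
    have hH : NoUniversal (⊥ : SimpleGraph (Fin 0)) := fun i => i.elim0
    rw [shiftedRank_iso hG ((isom_join_fin_zero n ⊥).2 hi)]
    exact (shiftedRank_join_fin hpos hH).2.2.2.1 (by omega)

theorem shiftedRank_ne_two (hG : G.Connected) : shiftedRank G ≠ 2 := by
  rcases dichotomy G with hu | hu
  · obtain ⟨h, H, hlt, hH, hi, he⟩ := exists_shiftedRank_eq hG rfl hu
    obtain ⟨h1, h2, h3, h4, h5⟩ := shiftedRank_join_fin (r := Fintype.card V - h) (by omega) hH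
    omega
  · have := (shiftedRank_of_forall_exists_not_adj hG hu).1
    omega

omit [Fintype V] [DecidableEq V] in
theorem isom_join_congr {r : ℕ} {X : Type*} {Y : Type*} {H : SimpleGraph X} {H' : SimpleGraph Y}
    (h : Isom H H') : Isom G (join (K r) H) ↔ Isom G (join (K r) H') :=
  ⟨fun h1 => h1.trans ((Isom.refl _).join h), fun h1 => h1.trans ((Isom.refl _).join h.symm)⟩

theorem isom_isolated (h : ℕ) : Isom (isolated h) (edgeGraph ([] : List (Fin h × Fin h))) := by
  refine ⟨⟨Equiv.refl _, ?_⟩⟩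
  simp [edgeGraph_adj, edgeBool]

theorem isom_sum_edgeGraph (a b : ℕ) (E : List (Fin (a + b) × Fin (a + b)))
    (A : SimpleGraph (Fin a)) (B : SimpleGraph (Fin b))
    (hA : ∀ i j, A.Adj i j ↔ (edgeGraph E).Adj (Fin.castAdd b i) (Fin.castAdd b j))
    (hB : ∀ i j, B.Adj i j ↔ (edgeGraph E).Adj (Fin.natAdd a i) (Fin.natAdd a j))
    (hAB : ∀ i j, ¬ (edgeGraph E).Adj (Fin.castAdd b i) (Fin.natAdd a j)) :
    Isom (SimpleGraph.sum A B) (edgeGraph E) := by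
  refine ⟨⟨finSumFinEquiv, ?_⟩⟩
  rintro (i | i) (j | j)
  · simp [hA]
  · simp [hAB]
  · simp [hAB, SimpleGraph.adj_comm _ (Fin.natAdd a i)]
  · simp [hB]

theorem isom_sum_two_one : Isom (SimpleGraph.sum (K 2) (K 1)) (edgeGraph (h := 3) [(0, 1)]) := by
  apply isom_sum_edgeGraph <;> simp only [edgeGraph_adj, SimpleGraph.top_adj] <;> decide

theorem isom_sum_isolated_two : Isom (SimpleGraph.sum (isolated 2) (K 2)) (edgeGraph (h := 4) [(2, 3)]) := by
  apply isom_sum_edgeGraph <;>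
    simp only [edgeGraph_adj, SimpleGraph.top_adj, SimpleGraph.emptyGraph_eq_bot, SimpleGraph.bot_adj] <;> decide

theorem isom_sum_path_three :
    Isom (SimpleGraph.sum (P 3) (K 1)) (edgeGraph (h := 4) [(0, 1), (1, 2)]) := by
  apply isom_sum_edgeGraph <;>
    simp only [edgeGraph_adj, SimpleGraph.top_adj, SimpleGraph.pathGraph_adj] <;> decide

theorem isom_sum_two_two : Isom (SimpleGraph.sum (K 2) (K 2)) (edgeGraph (h := 4) [(0, 1), (2, 3)]) := by
  apply isom_sum_edgeGraph <;> simp only [edgeGraph_adj, SimpleGraph.top_adj] <;> decide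

theorem isom_sum_three_one :
    Isom (SimpleGraph.sum (K 3) (K 1)) (edgeGraph (h := 4) [(0, 1), (1, 2), (0, 2)]) := by
  apply isom_sum_edgeGraph <;> simp only [edgeGraph_adj, SimpleGraph.top_adj] <;> decide

theorem isom_sum_one_path :
    Isom (SimpleGraph.sum (K 1) (P 4)) (edgeGraph (h := 5) [(1, 2), (2, 3), (3, 4)]) := by
  apply isom_sum_edgeGraph <;>
    simp only [edgeGraph_adj, SimpleGraph.top_adj, SimpleGraph.pathGraph_adj] <;> decide

theorem isom_path_four : Isom (P 4) (edgeGraph (h := 4) [(0, 1), (1, 2), (2, 3)]) := by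
  refine ⟨⟨Equiv.refl _, ?_⟩⟩
  simp only [edgeGraph_adj, SimpleGraph.pathGraph_adj, Equiv.refl_apply]
  decide

theorem isom_cycle_four : Isom (C 4) (edgeGraph (h := 4) [(0, 1), (1, 2), (2, 3), (0, 3)]) := by
  refine ⟨⟨Equiv.refl _, ?_⟩⟩
  simp only [edgeGraph_adj, SimpleGraph.cycleGraph_adj, Equiv.refl_apply]
  decide

theorem isom_cycle_five : Isom (C 5) (edgeGraph (h := 5) [(0, 1), (1, 2), (2, 3), (3, 4), (0, 4)]) := by
  refine ⟨⟨Equiv.refl _, ?_⟩⟩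
  simp only [edgeGraph_adj, SimpleGraph.cycleGraph_adj, Equiv.refl_apply]
  decide

theorem isom_bull : Isom bull (edgeGraph (h := 5) [(0, 1), (1, 2), (2, 3), (4, 1), (4, 2)]) := by
  refine ⟨⟨Equiv.refl _, ?_⟩⟩
  simp only [edgeGraph_adj, bull, Equiv.refl_apply, SimpleGraph.fromEdgeSet_adj,
    Set.mem_insert_iff, Set.mem_singleton_iff]
  decide

omit [Fintype V] [DecidableEq V] in
theorem inFamily3_iff (n : ℕ) : InFamily3 n G ↔ Isom G (P 4) ∨
    Isom G (join (K (n - 2)) (edgeGraph ([] : List (Fin 2 × Fin 2)))) := by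
  rw [InFamily3, isom_join_congr (isom_isolated 2)]

omit [Fintype V] [DecidableEq V] in
theorem inFamily4_iff (n : ℕ) : InFamily4 n G ↔
    ∃ E ∈ edgeListsThree, Isom G (join (K (n - 3)) (edgeGraph E)) := by
  rw [InFamily4, isom_join_congr (isom_isolated 3), isom_join_congr isom_sum_two_one]
  simp [edgeListsThree]

omit [Fintype V] [DecidableEq V] in
theorem inFamily5_iff (n : ℕ) : InFamily5 n G ↔
    (∃ E ∈ edgeListsFour, Isom G (join (K (n - 4)) (edgeGraph E))) ∨
    (∃ E ∈ edgeListsFive, Isom G (join (K (n - 5)) (edgeGraph E))) := by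
  rw [InFamily5, isom_join_congr (isom_isolated 4), isom_join_congr isom_sum_isolated_two,
    isom_join_congr isom_sum_path_three, isom_join_congr isom_sum_two_two,
    isom_join_congr isom_path_four, isom_join_congr isom_sum_three_one,
    isom_join_congr isom_cycle_four, isom_join_congr isom_cycle_five,
    isom_join_congr isom_sum_one_path, isom_join_congr isom_bull]
  simp [edgeListsFour, edgeListsFive, or_assoc]

theorem noUniversal_edgeGraph_nil_two : NoUniversal (edgeGraph ([] : List (Fin 2 × Fin 2))) :=
  noUniversal_edgeGraph _ (by decide)

theorem shiftedRank_eq_three_iff (hG : G.Connected) {n : ℕ} (hn : Fintype.card V = n)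
    (h4n : 4 ≤ n) : shiftedRank G = 3 ↔ InFamily3 n G := by
  rw [inFamily3_iff]
  constructor
  · intro hk
    rcases dichotomy G with hu | hu
    · obtain ⟨h, H, hlt, hH, hi, he⟩ := exists_shiftedRank_eq hG hn hu
      obtain ⟨h1, h2, h3, h4, h5⟩ := shiftedRank_join_fin (r := n - h) (by omega) hH
      obtain rfl : h = 2 := by omega
      right
      rw [eq_bot_of_noUniversal_fin_two H hH] at hi
      exact (isom_join_congr (isom_isolated 2)).1 hi
    · rcases (shiftedRank_of_forall_exists_not_adj hG hu).2.1 hk with h | h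
      · exact Or.inl h
      · omega
  · rintro (hi | hi)
    · rw [shiftedRank_iso hG hi, shiftedRank_pathGraph_four]
    · rw [shiftedRank_iso hG hi]
      exact (shiftedRank_join_fin (by omega) noUniversal_edgeGraph_nil_two).2.2.2.1 (by omega)

theorem shiftedRank_eq_four_iff (hG : G.Connected) {n : ℕ} (hn : Fintype.card V = n)
    (h9n : 9 ≤ n) : shiftedRank G = 4 ↔ InFamily4 n G := by
  rw [inFamily4_iff]
  constructor
  · intro hk
    rcases dichotomy G with hu | hu
    · obtain ⟨h, H, hlt, hH, hi, he⟩ := exists_shiftedRank_eq hG hn hu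
      obtain ⟨h1, h2, h3, h4, h5⟩ := shiftedRank_join_fin (r := n - h) (by omega) hH
      obtain rfl : h = 3 := by omega
      obtain ⟨E, hE, hEi⟩ := isom_of_noUniversal_fin_three H hH
      exact ⟨E, hE, (isom_join_congr hEi).1 hi⟩
    · have := (shiftedRank_of_forall_exists_not_adj hG hu).2.2.1 hk
      omega
  · rintro ⟨E, hE, hi⟩
    rw [shiftedRank_iso hG hi]
    exact (shiftedRank_join_fin (by omega) (noUniversal_edgeListsThree E hE)).2.2.2.1 (by omega)

theorem shiftedRank_eq_five_iff (hG : G.Connected) {n : ℕ} (hn : Fintype.card V = n)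
    (h16n : 16 ≤ n) : shiftedRank G = 5 ↔ InFamily5 n G := by
  rw [inFamily5_iff]
  constructor
  · intro hk
    rcases dichotomy G with hu | hu
    · obtain ⟨h, H, hlt, hH, hi, he⟩ := exists_shiftedRank_eq hG hn hu
      obtain ⟨h1, h2, h3, h4, h5⟩ := shiftedRank_join_fin (r := n - h) (by omega) hH
      obtain rfl | rfl : h = 4 ∨ h = 5 := by omega
      · obtain ⟨E, hE, hEi⟩ := isom_of_noUniversal_fin_four H hH
        exact Or.inl ⟨E, hE, (isom_join_congr hEi).1 hi⟩
      · obtain ⟨E, hE, hEi⟩ := isom_of_noUniversal_fin_five H hH (h5 rfl (by omega))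
        exact Or.inr ⟨E, hE, (isom_join_congr hEi).1 hi⟩
    · have := (shiftedRank_of_forall_exists_not_adj hG hu).2.2.2 hk
      omega
  · rintro (⟨E, hE, hi⟩ | ⟨E, hE, hi⟩)
    · rw [shiftedRank_iso hG hi]
      exact (shiftedRank_join_fin (by omega) (noUniversal_edgeListsFour E hE)).2.2.2.1 (by omega)
    · rw [shiftedRank_iso hG hi, shiftedRank_join_of_det_eq_zero (by omega)
        (noUniversal_edgeListsFive E hE) (det_seidelMatrix_edgeListsFive E hE), Fintype.card_fin]

variable {W : Type v} [Fintype W] [DecidableEq W] {H : SimpleGraph W}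

/-- The two members can be cospectral only for n = 4, where their second moments are 38 for P_4 and
22 for the join. -/
theorem isom_of_inFamily3 (hG : G.Connected) (hH : H.Connected) {n : ℕ}
    (hn : Fintype.card V = n) (h4n : 4 ≤ n) (hm : ∀ k, shiftedMoment H k = shiftedMoment G k)
    (h1 : InFamily3 n H) (h2 : InFamily3 n G) (hc : Fintype.card W = n) : Isom H G := by
  have key : n = 4 → shiftedMoment (join (K (n - 2)) (edgeGraph ([] : List (Fin 2 × Fin 2)))) 2
      ≠ 38 := by
    rintro rfl
    rw [shiftedMoment_two (by omega) noUniversal_edgeGraph_nil_two]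
    have : traceTwo ([] : List (Fin 2 × Fin 2)) = 10 := by decide +kernel
    rw [this]
    norm_num
  rw [inFamily3_iff] at h1 h2
  rcases h1 with h1 | h1 <;> rcases h2 with h2 | h2
  · exact h1.trans h2.symm
  · exfalso
    have h3 := h1.card_eq
    rw [hc, Fintype.card_fin] at h3
    apply key h3
    rw [← shiftedMoment_iso hG h2, ← hm, shiftedMoment_iso hH h1, shiftedMoment_pathGraph_four]
  · exfalso
    have h3 := h2.card_eq
    rw [hn, Fintype.card_fin] at h3
    apply key h3
    rw [← shiftedMoment_iso hH h1, hm, shiftedMoment_iso hG h2, shiftedMoment_pathGraph_four]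
  · exact h1.trans h2.symm

theorem isom_of_inFamily4 (hG : G.Connected) (hH : H.Connected) {n : ℕ} (h9n : 9 ≤ n)
    (hm : ∀ k, shiftedMoment H k = shiftedMoment G k)
    (h1 : InFamily4 n H) (h2 : InFamily4 n G) : Isom H G := by
  rw [inFamily4_iff] at h1 h2
  obtain ⟨E, hE, h1⟩ := h1
  obtain ⟨E', hE', h2⟩ := h2
  obtain rfl : E = E' := eq_of_shiftedMoment_eq (r := n - 3) (by omega)
    (noUniversal_edgeListsThree E hE) (noUniversal_edgeListsThree E' hE')
    (separatedByMoments_edgeListsThree E hE E' hE') fun k => by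
      rw [← shiftedMoment_iso hH h1, ← shiftedMoment_iso hG h2, hm]
  exact h1.trans h2.symm

theorem isom_of_inFamily5 (hG : G.Connected) (hH : H.Connected) {n : ℕ} (h16n : 16 ≤ n)
    (hm : ∀ k, shiftedMoment H k = shiftedMoment G k)
    (h1 : InFamily5 n H) (h2 : InFamily5 n G) : Isom H G := by
  rw [inFamily5_iff] at h1 h2
  -- For equal n, a graph H on four vertices comes with a clique one larger than does a graph on
  -- five.
  have hr : n - 4 = n - 5 + 1 := by omega
  rcases h1 with ⟨E, hE, h1⟩ | ⟨E, hE, h1⟩ <;> rcases h2 with ⟨E', hE', h2⟩ | ⟨E', hE', h2⟩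
  · obtain rfl : E = E' := eq_of_shiftedMoment_eq (r := n - 4) (by omega)
      (noUniversal_edgeListsFour E hE) (noUniversal_edgeListsFour E' hE')
      (separatedByMoments_edgeListsFour E hE E' hE') fun k => by
        rw [← shiftedMoment_iso hH h1, ← shiftedMoment_iso hG h2, hm]
    exact h1.trans h2.symm
  · rw [hr] at h1
    refine absurd (fun k => ?_) (shiftedMoment_four_vertices_ne_five_vertices (r := n - 5)
      (by omega) E hE E' hE')
    rw [← shiftedMoment_iso hH h1, ← shiftedMoment_iso hG h2, hm]
  · rw [hr] at h2
    refine absurd (fun k => ?_) (shiftedMoment_four_vertices_ne_five_vertices (r := n - 5)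
      (by omega) E' hE' E hE)
    rw [← shiftedMoment_iso hH h1, ← shiftedMoment_iso hG h2, hm]
  · obtain rfl : E = E' := eq_of_shiftedMoment_eq (r := n - 5) (by omega)
      (noUniversal_edgeListsFive E hE) (noUniversal_edgeListsFive E' hE')
      (separatedByMoments_edgeListsFive E hE E' hE') fun k => by
        rw [← shiftedMoment_iso hH h1, ← shiftedMoment_iso hG h2, hm]
    exact h1.trans h2.symm

theorem shiftedRank_eq_of_eccSpectrum_eq (hG : G.Connected) (hH : H.Connected)
    (h : eccSpectrum H = eccSpectrum G) : shiftedRank H = shiftedRank G := by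
  have h1 := eccMult_add_shiftedRank hG
  have h2 := eccMult_add_shiftedRank hH
  have h3 := card_eq_of_eccSpectrum_eq h
  have h4 := eccMult_eq_of_eccSpectrum_eq h (-1)
  omega

end Families

end EccentricityMatrix

/-- The multiplicity is compared in ℤ, so n - k is not truncated; then m(-1) = n - k means rank k.
In (i) the rank alone determines the graph, and the later families also need the moments. -/
theorem theorem1 {V : Type*} [Fintype V] [DecidableEq V] (G : SimpleGraph V)
    (hG : G.Connected) (n : ℕ) (hn : Fintype.card V = n) :
    -- (i)
    (((EccentricityMatrix.eccMult G (-1) : ℤ) = (n : ℤ) - 1 ↔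
        EccentricityMatrix.Isom G (EccentricityMatrix.K n)) ∧
      (EccentricityMatrix.Isom G (EccentricityMatrix.K n) →
        EccentricityMatrix.DeterminedByEccSpectrum G)) ∧
    -- (ii)
    ((EccentricityMatrix.eccMult G (-1) : ℤ) ≠ (n : ℤ) - 2) ∧
    -- (iii)
    (4 ≤ n →
      ((EccentricityMatrix.eccMult G (-1) : ℤ) = (n : ℤ) - 3 ↔
        EccentricityMatrix.InFamily3 n G) ∧
      (EccentricityMatrix.InFamily3 n G → EccentricityMatrix.DeterminedByEccSpectrum G)) ∧
    -- (iv)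
    (9 ≤ n →
      ((EccentricityMatrix.eccMult G (-1) : ℤ) = (n : ℤ) - 4 ↔
        EccentricityMatrix.InFamily4 n G) ∧
      (EccentricityMatrix.InFamily4 n G → EccentricityMatrix.DeterminedByEccSpectrum G)) ∧
    -- (v)
    (16 ≤ n →
      ((EccentricityMatrix.eccMult G (-1) : ℤ) = (n : ℤ) - 5 ↔
        EccentricityMatrix.InFamily5 n G) ∧
      (EccentricityMatrix.InFamily5 n G → EccentricityMatrix.DeterminedByEccSpectrum G)) := by
  have hrank := EccentricityMatrix.eccMult_add_shiftedRank hG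
  have hcard : ∀ {W : Type _} [Fintype W] [DecidableEq W] (H : SimpleGraph W),
      EccentricityMatrix.eccSpectrum H = EccentricityMatrix.eccSpectrum G →
      Fintype.card W = n := fun H h =>
    (EccentricityMatrix.card_eq_of_eccSpectrum_eq h).trans hn
  rw [hn] at hrank
  refine ⟨⟨?_, ?_⟩, ?_, fun h4 => ⟨?_, ?_⟩, fun h9 => ⟨?_, ?_⟩, fun h16 => ⟨?_, ?_⟩⟩
  · rw [← EccentricityMatrix.shiftedRank_eq_one_iff hG hn]
    omega
  · intro h1 W _ _ H hH hs
    have h2 := (EccentricityMatrix.shiftedRank_eq_one_iff hG hn).2 h1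
    rw [← EccentricityMatrix.shiftedRank_eq_of_eccSpectrum_eq hG hH hs] at h2
    exact ((EccentricityMatrix.shiftedRank_eq_one_iff hH (hcard H hs)).1 h2).trans h1.symm
  · have := EccentricityMatrix.shiftedRank_ne_two hG
    omega
  · rw [← EccentricityMatrix.shiftedRank_eq_three_iff hG hn h4]
    omega
  · intro h1 W _ _ H hH hs
    have h2 := (EccentricityMatrix.shiftedRank_eq_three_iff hG hn h4).2 h1
    rw [← EccentricityMatrix.shiftedRank_eq_of_eccSpectrum_eq hG hH hs,
      EccentricityMatrix.shiftedRank_eq_three_iff hH (hcard H hs) h4] at h2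
    exact EccentricityMatrix.isom_of_inFamily3 hG hH hn h4
      (EccentricityMatrix.shiftedMoment_eq_of_eccSpectrum_eq hH hG hs) h2 h1 (hcard H hs)
  · rw [← EccentricityMatrix.shiftedRank_eq_four_iff hG hn h9]
    omega
  · intro h1 W _ _ H hH hs
    have h2 := (EccentricityMatrix.shiftedRank_eq_four_iff hG hn h9).2 h1
    rw [← EccentricityMatrix.shiftedRank_eq_of_eccSpectrum_eq hG hH hs,
      EccentricityMatrix.shiftedRank_eq_four_iff hH (hcard H hs) h9] at h2
    exact EccentricityMatrix.isom_of_inFamily4 hG hH h9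
      (EccentricityMatrix.shiftedMoment_eq_of_eccSpectrum_eq hH hG hs) h2 h1
  · rw [← EccentricityMatrix.shiftedRank_eq_five_iff hG hn h16]
    omega
  · intro h1 W _ _ H hH hs
    have h2 := (EccentricityMatrix.shiftedRank_eq_five_iff hG hn h16).2 h1
    rw [← EccentricityMatrix.shiftedRank_eq_of_eccSpectrum_eq hG hH hs,
      EccentricityMatrix.shiftedRank_eq_five_iff hH (hcard H hs) h16] at h2
    exact EccentricityMatrix.isom_of_inFamily5 hG hH h16
      (EccentricityMatrix.shiftedMoment_eq_of_eccSpectrum_eq hH hG hs) h2 h1
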